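/- Let $q$ be a power of an odd prime, $n\ge 0$ an integer, $N=2n+1,\ \tilde n=n+1$ in type $\mathfrak B_n$ and $N=2n,\ \tilde n=n$ in types $\mathfrak C_n,\mathfrak D_n$; write $\bar i=N+1-i$ for $1\le i\le N$. Let $S$ be the $N\times N$ matrix over $\mathbb F_q$ with $S_{i\bar i}=1$ for all $i$, except that $S_{i\bar i}=-1$ for $i>n$ in type $\mathfrak C_n$, and all other entries $0$. Let $U$ be the group of all upper unitriangular $u\in GL_N(q)$ with $u^tSu=S$. Put $\mathrm{UP}=\{(i,j)\mid i<j<\bar i\}$, and let $\Phi^+=\mathrm{UP}$ in types $\mathfrak B_n,\mathfrak D_n$ and $\Phi^+=\mathrm{UP}\cup\{(i,\bar i)\mid i<\bar i\}$ in type $\mathfrak C_n$. The left triangle is $\{(i,j)\in\Phi^+\mid j\le\tilde n\}$, the right triangle is $\{(i,j)\in\Phi^+\mid j>\tilde n\}$. With $e_{ij}$ the matrix units, the root elements of $U$ are, for $(i,j)\in\Phi^+$ and $\lambda\in\mathbb F_q$: $x_{i,n+1}(\lambda)=1+\lambda e_{i,n+1}-\lambda e_{n+1,\bar i}-\tfrac12\lambda^2e_{i\bar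 i}$ in type $\mathfrak B_n$; $x_{i\bar i}(\lambda)=1+\lambda e_{i\bar i}$ and $x_{ij}(\lambda)=1+\lambda e_{ij}+\lambda e_{\bar j\bar i}$ for $n<j<\bar i$ in type $\mathfrak C_n$; and $x_{ij}(\lambda)=1+\lambda e_{ij}-\lambda e_{\bar j\bar i}$ in all other cases. Fix a non-trivial character $\theta$ of $(\mathbb F_q,+)$ with values in $\mathbb C^*$. For $(i,j)\in\Phi^+$ put $$\varrho_{i,j}=\begin{cases}\{(i,k)\in\Phi^+\mid k<j\}&\text{if }j\le\tilde n,\\ \{(i,k)\in\Phi^+\mid k\le n\}\cup\{(\bar j,l)\in\Phi^+\mid l\le\tilde n\}&\text{if }j>\tilde n,\end{cases}$$ let $U_{i,j}$ be the subgroup of $U$ generated by all $x_{rs}(\lambda)$ with $(r,s)\in\Phi^+\setminus\varrho_{i,j}$ and $\lambda\in\mathbb F_q$, and for $0\ne\alpha\in\mathbb F_q$ let the elementary character $\xi^{i,j}_\alpha$ be the character of $U$ induced from the linear character $u\mapsto\theta(\alpha u_{ij})$ of $U_{i,j}$. Let $V$ be the space of $N\times N$ matrices over $\mathbb F_q$ supported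 in $\Phi^+$, and let $\pi$ be the projection of all $N\times N$ matrices onto $V$ which replaces the entries outside $\Phi^+$ by $0$. Let $\mathbb C\hat V$ be the right $\mathbb CU$-module with basis $\{[A]\mid A\in V\}$ and monomial action $$[A]u=\theta\bigl(-\operatorname{tr}(A^tu^{-1})\bigr)\,[A].u,\qquad [A].u=[\pi(Au^{-t})],\qquad u^{-t}=(u^{-1})^t .$$ For $A\in V$ let $\mathcal O_A=\{[A].u\mid u\in U\}$, and let $\mathbb C\mathcal O_A$ be the submodule with basis $\mathcal O_A$. Let $\operatorname{verge}(A)$ be obtained from $A$ by keeping in every row only the rightmost non-zero entry, and let $\mathbb C\mathcal V(A)$ be the submodule with basis $\{[B]\mid B\in V,\ \operatorname{verge}(B)=\operatorname{verge}(A)\}$. Theorem. Let $(i,j)\in\Phi^+$, $0\ne\alpha\in\mathbb F_q$, $A=\alpha e_{ij}$, and let $M$ be a finite-dimensional right $\mathbb CU$-module affording the elementary character $\xi^{i,j}_\alpha$. 1) If $(i,j)$ lies in the left triangle, or if the type is $\mathfrak C_n$ and $(i,j)\in\mathrm{UP}$, then $M$ is irreducible and $M\cong\mathbb C\mathcal O_A$.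 2) If the type is $\mathfrak B_n$ or $\mathfrak D_n$ and $(i,j)$ lies in the right triangle, put $A_\beta=\beta e_{i\bar j}+\alpha e_{ij}\in V$ for $\beta\in\mathbb F_q$. Then $$M\cong\mathbb C\mathcal V(A)=\bigoplus_{\beta\in\mathbb F_q}\mathbb C\mathcal O_{A_\beta},$$ and the $q$ modules $\mathbb C\mathcal O_{A_\beta}$ are irreducible and pairwise non-isomorphic. 3) If the type is $\mathfrak C_n$ and $j=\bar i$, then $M$ is irreducible and occurs in $\mathbb C\mathcal O_A$ with multiplicity $1$, that is, $\dim_{\mathbb C}\operatorname{Hom}_{\mathbb CU}(M,\mathbb C\mathcal O_A)=1$. -/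

import Mathlib

open scoped Matrix

/-- The three untwisted Dynkin types `𝔅ₙ`, `ℭₙ`, `𝔇ₙ`. -/
inductive DynkinType where
  | B : DynkinType
  | C : DynkinType
  | D : DynkinType
  deriving DecidableEq

namespace ClassicalUnipotent

/-- The matrix size: `N = 2n+1` in type `𝔅ₙ`, and `N = 2n` in types `ℭₙ`, `𝔇ₙ`. -/
abbrev size (t : DynkinType) (n : ℕ) : ℕ := if t = .B then 2 * n + 1 else 2 * n

/-- `ñ = n+1` in type `𝔅ₙ`, and `ñ = n` in types `ℭₙ`, `𝔇ₙ`. -/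
def nTilde (t : DynkinType) (n : ℕ) : ℕ := if t = .B then n + 1 else n

/-!
Rows and columns are indexed by `Fin N`, hence from `0`: the index written `i` in the range
`1, …, N` is `(i : ℕ) + 1` here, so that `i ≤ m` reads `(i : ℕ) < m`.
The mirror map `i ↦ N + 1 - i` is `Fin.rev`.
-/

/-- A position in an `N × N` matrix. -/
abbrev Pos (t : DynkinType) (n : ℕ) : Type := Fin (size t n) × Fin (size t n)

/-- The `N × N` matrices over `F`. -/
abbrev Mat (t : DynkinType) (n : ℕ) (F : Type*) : Type _ :=
  Matrix (Fin (size t n)) (Fin (size t n)) F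

/-- The positions strictly above the diagonal and strictly above (to the left of) the
antidiagonal: `i < j < N + 1 - i`. -/
def upperPos (t : DynkinType) (n : ℕ) : Finset (Pos t n) :=
  Finset.univ.filter fun p => p.1 < p.2 ∧ p.2 < p.1.rev

/-- The positions which label the positive roots: `upperPos` in types `𝔅ₙ`, `𝔇ₙ`, and `upperPos`
together with the upper half `{(i, j) | i < j, j = N + 1 - i}` of the antidiagonal in type `ℭₙ`. -/
def rootPos (t : DynkinType) (n : ℕ) : Finset (Pos t n) :=
  Finset.univ.filter fun p => p.1 < p.2 ∧ (p.2 < p.1.rev ∨ (t = .C ∧ p.2 = p.1.rev))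

/-- The left triangle: the root positions `(i, j)` with `j ≤ ñ`. -/
def leftTriangle (t : DynkinType) (n : ℕ) : Finset (Pos t n) :=
  (rootPos t n).filter fun p => (p.2 : ℕ) < nTilde t n

/-- The right triangle: the root positions `(i, j)` with `j > ñ`. -/
def rightTriangle (t : DynkinType) (n : ℕ) : Finset (Pos t n) :=
  (rootPos t n).filter fun p => nTilde t n ≤ (p.2 : ℕ)

section Group

variable (t : DynkinType) (n : ℕ) (F : Type*) [Field F]

/-- The nonzero entry in row `i` of the Gram matrix. -/
def formSign (i : Fin (size t n)) : F := if t = .C ∧ n ≤ (i : ℕ) then -1 else 1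

/-- The Gram matrix `S`: antidiagonal with all entries `1`, except in type `ℭₙ`, where the entries
in the rows `n+1, …, 2n` are `-1`. -/
def gram : Mat t n F := Matrix.of fun i j => if j = i.rev then formSign t n F i else 0

/-- The group `U_N(q)` of upper unitriangular matrices. -/
def unitriangular : Subgroup (GL (Fin (size t n)) F) where
  carrier := {g | (∀ i j, j < i → (g : Mat t n F) i j = 0) ∧ ∀ i, (g : Mat t n F) i i = 1}
  one_mem' := ⟨fun i j h => by simp [h.ne'], fun i => by simp⟩
  mul_mem' := by
    rintro a b ⟨ha, ha'⟩ ⟨hb, hb'⟩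
    refine ⟨fun i j h => ?_, fun i => ?_⟩
    · rw [Units.val_mul, Matrix.mul_apply]
      refine Finset.sum_eq_zero fun k _ => ?_
      rcases lt_or_ge k i with hk | hk
      · rw [ha i k hk, zero_mul]
      · rw [hb k j (h.trans_le hk), mul_zero]
    · rw [Units.val_mul, Matrix.mul_apply, Finset.sum_eq_single i]
      · rw [ha', hb', mul_one]
      · intro k _ hk
        rcases lt_or_gt_of_ne hk with hk | hk
        · rw [ha i k hk, zero_mul]
        · rw [hb k i hk, mul_zero]
      · simp
  inv_mem' := by
    rintro a ⟨ha, ha'⟩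
    have htri : ∀ i j, j < i → ((a⁻¹ : GL (Fin (size t n)) F) : Mat t n F) i j = 0 := by
      have h1 : (a : Mat t n F).BlockTriangular id := fun i j h => ha i j h
      let _ : Invertible (a : Mat t n F) := a.isUnit.invertible
      have h2 := Matrix.blockTriangular_inv_of_blockTriangular h1
      intro i j h
      rw [Matrix.coe_units_inv]
      exact h2 h
    refine ⟨htri, fun i => ?_⟩
    have h := congrFun (congrFun (Units.mul_inv a) i) i
    rw [Matrix.mul_apply, Finset.sum_eq_single i, ha', one_mul, Matrix.one_apply_eq] at h
    · exact h
    · intro k _ hk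
      rcases lt_or_gt_of_ne hk with hk | hk
      · rw [ha i k hk, zero_mul]
      · rw [htri k i hk, mul_zero]
    · simp

/-- The orthogonal (types `𝔅ₙ`, `𝔇ₙ`) or symplectic (type `ℭₙ`) group: the invertible matrices
which leave the bilinear form `⟨v, w⟩ = vᵗ S w` invariant. -/
def classicalGroup : Subgroup (GL (Fin (size t n)) F) where
  carrier := {g | (g : Mat t n F)ᵀ * gram t n F * (g : Mat t n F) = gram t n F}
  one_mem' := by simp
  mul_mem' := by
    intro a b ha hb
    simp only [Set.mem_ofPred_eq, Units.val_mul, Matrix.transpose_mul] at *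
    calc _ = (b : Mat t n F)ᵀ * ((a : Mat t n F)ᵀ * gram t n F * (a : Mat t n F))
          * (b : Mat t n F) := by simp only [Matrix.mul_assoc]
      _ = _ := by rw [ha, hb]
  inv_mem' := by
    intro a ha
    simp only [Set.mem_ofPred_eq] at *
    have h1 : (a : Mat t n F) * ((a⁻¹ : GL (Fin (size t n)) F) : Mat t n F) = 1 := Units.mul_inv a
    have h2 : ((a⁻¹ : GL (Fin (size t n)) F) : Mat t n F)ᵀ * (a : Mat t n F)ᵀ = 1 := by
      rw [← Matrix.transpose_mul, h1, Matrix.transpose_one]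
    conv_lhs => rw [← ha]
    calc _ = (((a⁻¹ : GL (Fin (size t n)) F) : Mat t n F)ᵀ * (a : Mat t n F)ᵀ) * gram t n F *
          ((a : Mat t n F) * ((a⁻¹ : GL (Fin (size t n)) F) : Mat t n F)) := by
            simp only [Matrix.mul_assoc]
      _ = _ := by rw [h1, h2, Matrix.one_mul, Matrix.mul_one]

/-- The group `U = G ∩ U_N(q)`, a `p`-Sylow subgroup of the classical group `G`. -/
def sylowU : Subgroup (GL (Fin (size t n)) F) := classicalGroup t n F ⊓ unitriangular t n F

end Group

section Roots

variable {t : DynkinType} {n : ℕ} {F : Type*} [Field F]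

/-- The underlying matrix of an element of `U`. -/
def toMat (u : sylowU t n F) : Mat t n F := ((u : GL (Fin (size t n)) F) : Mat t n F)

/-- The root element `x_{ij}(α)`:
* `1 + α e_{i,n+1} - α e_{n+1,ī} - (α²/2) e_{i,ī}` in type `𝔅ₙ` with `j = n+1`,
* `1 + α e_{i,ī}` in type `ℭₙ` with `j = ī`,
* `1 + α e_{ij} + α e_{j̄,ī}` in type `ℭₙ` with `n < j < ī`,
* `1 + α e_{ij} - α e_{j̄,ī}` in all other cases. -/
def rootMatrix (i j : Fin (size t n)) (α : F) : Mat t n F :=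
  if t = .B ∧ (j : ℕ) = n then
    1 + Matrix.single i j α - Matrix.single j i.rev α - Matrix.single i i.rev (α ^ 2 / 2)
  else if t = .C ∧ j = i.rev then
    1 + Matrix.single i j α
  else if t = .C ∧ n ≤ (j : ℕ) then
    1 + Matrix.single i j α + Matrix.single j.rev i.rev α
  else
    1 + Matrix.single i j α - Matrix.single j.rev i.rev α

variable (F) in
/-- The pattern subgroup `U_J` of `U`, generated by the root elements `x_{ij}(α)` with
`(i, j) ∈ J` and `α ∈ F`. -/
def patternSubgroup (J : Finset (Pos t n)) : Subgroup (sylowU t n F) :=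
  Subgroup.closure {u | ∃ p ∈ J, ∃ α : F, toMat u = rootMatrix p.1 p.2 α}

/-- The set `ϱ_{i,j}` of positions which are removed:
`{(i, k) | i < k < j}` if `(i, j)` is in the left triangle, and
`{(i, k) | i < k ≤ n} ∪ {(j̄, l) | j̄ < l ≤ ñ}` if `(i, j)` is in the right triangle. -/
def removed (i j : Fin (size t n)) : Finset (Pos t n) :=
  if (j : ℕ) < nTilde t n then
    (rootPos t n).filter fun p => p.1 = i ∧ p.2 < j
  else
    (rootPos t n).filter fun p =>
      (p.1 = i ∧ (p.2 : ℕ) < n) ∨ (p.1 = j.rev ∧ (p.2 : ℕ) < nTilde t n)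

variable (F) in
/-- The subgroup `U_{i,j}`: the pattern subgroup for the root positions outside `ϱ_{i,j}`. -/
def elementarySubgroup (i j : Fin (size t n)) : Subgroup (sylowU t n F) :=
  patternSubgroup F (rootPos t n \ removed i j)

theorem toMat_mul (u v : sylowU t n F) : toMat (u * v) = toMat u * toMat v := rfl

theorem toMat_one : toMat (1 : sylowU t n F) = 1 := rfl

theorem toMat_lower (u : sylowU t n F) {i j : Fin (size t n)} (h : j < i) :
    toMat u i j = 0 := u.2.2.1 i j h

theorem toMat_diag (u : sylowU t n F) (i : Fin (size t n)) : toMat u i i = 1 := u.2.2.2 i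

theorem toMat_inv_rev (u : sylowU t n F) (a b : Fin (size t n)) :
    toMat u⁻¹ a.rev b.rev = 0 → toMat u b a = 0 := by
  intro h
  have h1 : (toMat u)ᵀ * gram t n F * toMat u = gram t n F := u.2.1
  have h2 : toMat u * toMat u⁻¹ = 1 := by rw [← toMat_mul, mul_inv_cancel, toMat_one]
  have h3 : (toMat u)ᵀ * gram t n F = gram t n F * toMat u⁻¹ := by
    calc _ = (toMat u)ᵀ * gram t n F * (toMat u * toMat u⁻¹) := by rw [h2, Matrix.mul_one]
      _ = _ := by rw [← Matrix.mul_assoc, h1]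
  have h4 := congrFun (congrFun h3 a) b.rev
  rw [Matrix.mul_apply, Matrix.mul_apply, Finset.sum_eq_single b, Finset.sum_eq_single a.rev, h] at h4
  · have : formSign t n F b ≠ 0 := by unfold formSign; split_ifs <;> simp
    simpa [gram, this] using h4
  · intro k _ hk
    simp [gram, hk]
  · simp
  · intro k _ hk
    have : b.rev ≠ k.rev := fun h => hk (Fin.rev_injective h).symm
    simp [gram, this]
  · simp

theorem removed_row {i j a b c : Fin (size t n)} (h : (a, b) ∈ removed i j) (hac : a < c)
    (hcb : c ≤ b) : (a, c) ∈ removed i j := by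
  unfold removed at *
  have hr : (a, b) ∈ rootPos t n → (a, c) ∈ rootPos t n := by
    simp only [rootPos, Finset.mem_filter, Finset.mem_univ, true_and]
    rintro ⟨_, h | h⟩
    · exact ⟨hac, Or.inl (hcb.trans_lt h)⟩
    · rcases hcb.lt_or_eq with h' | h'
      · exact ⟨hac, Or.inl (h'.trans_eq h.2)⟩
      · exact ⟨hac, Or.inr ⟨h.1, h'.trans h.2⟩⟩
  split_ifs at * with hj
  · simp only [Finset.mem_filter] at *
    exact ⟨hr h.1, h.2.1, hcb.trans_lt h.2.2⟩
  · simp only [Finset.mem_filter] at *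
    have : (c : ℕ) ≤ b := hcb
    refine ⟨hr h.1, ?_⟩
    rcases h.2 with h | h
    · exact Or.inl ⟨h.1, by omega⟩
    · exact Or.inr ⟨h.1, by omega⟩

theorem mul_apply_removed {i j a b : Fin (size t n)} (h : (a, b) ∈ removed i j)
    {u v : sylowU t n F} (hu : ∀ p ∈ removed i j, toMat u p.1 p.2 = 0) :
    toMat (u * v) a b = toMat v a b := by
  rw [toMat_mul, Matrix.mul_apply, Finset.sum_eq_single a]
  · rw [toMat_diag, one_mul]
  · intro c _ hc
    rcases lt_or_gt_of_ne hc with hc | hc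
    · rw [toMat_lower u hc, zero_mul]
    · rcases le_or_gt c b with hb | hb
      · rw [hu _ (removed_row h hc hb), zero_mul]
      · rw [toMat_lower v hb, mul_zero]
  · simp

theorem elementarySubgroup_removed {i j : Fin (size t n)} {u : sylowU t n F}
    (hu : u ∈ elementarySubgroup F i j) : ∀ p ∈ removed i j, toMat u p.1 p.2 = 0 := by
  unfold elementarySubgroup patternSubgroup at hu
  induction hu using Subgroup.closure_induction with
  | mem u hu =>
    obtain ⟨⟨r, s⟩, hp, α, hu⟩ := hu
    rintro ⟨a, b⟩ hab
    simp only at *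
    have habr : (a, b) ∈ rootPos t n := by
      unfold removed at hab
      split_ifs at hab <;> exact (Finset.mem_filter.1 hab).1
    have hne : ¬ (r = a ∧ s = b) := by
      rintro ⟨rfl, rfl⟩
      exact (Finset.mem_sdiff.1 hp).2 hab
    have hrs := (Finset.mem_sdiff.1 hp).1
    simp only [rootPos, Finset.mem_filter, Finset.mem_univ, true_and, Fin.lt_def, Fin.ext_iff,
      Fin.val_rev] at hrs habr
    have h1 : ¬ (r = a ∧ r.rev = b ∧ t = .B) := by
      rintro ⟨rfl, rfl, rfl⟩
      simp at habr
    have hab' : a ≠ b := by rintro rfl; exact lt_irrefl _ habr.1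
    have h2 : ¬ (s.rev = a ∧ r.rev = b) ∨ s = r.rev := by
      by_contra hcon
      push Not at hcon
      obtain ⟨⟨rfl, rfl⟩, hc⟩ := hcon
      simp only [Fin.val_rev, Fin.ext_iff, ne_eq] at *
      omega
    have h3 : t = .B → (s : ℕ) = n → s.rev = s := by
      intro ht hs
      ext
      simp only [Fin.val_rev, size, ht, if_true]
      omega
    rw [hu]
    unfold rootMatrix
    split_ifs with c1 c2 c3
    · rw [h3 c1.1 c1.2] at h2
      have : ¬ (s = a ∧ r.rev = b) := by
        rcases h2 with h2 | h2
        · exact h2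
        · rcases c1 with ⟨rfl, c1⟩
          exfalso
          simp [h2] at hrs
      have h1' : ¬ (r = a ∧ r.rev = b) := fun h => h1 ⟨h.1, h.2, c1.1⟩
      simp [hne, hab', this, h1']
    · simp [hne, hab']
    · have : ¬ (s.rev = a ∧ r.rev = b) := h2.resolve_right fun h => c2 ⟨c3.1, h⟩
      simp [hne, hab', this]
    · have : ¬ (s.rev = a ∧ r.rev = b) := by
        rcases h2 with h2 | h2
        · exact h2
        · intro _
          have : t ≠ .C := fun h => c2 ⟨h, h2⟩
          simp [h2, this] at hrs
      simp [hne, hab', this]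
  | one =>
    rintro ⟨a, b⟩ hab
    have : a ≠ b := by
      rintro rfl
      have habr : (a, a) ∈ rootPos t n := by
        unfold removed at hab
        split_ifs at hab <;> exact (Finset.mem_filter.1 hab).1
      simp [rootPos] at habr
    simp [toMat_one, this]
  | mul u v _ _ hu hv =>
    rintro ⟨a, b⟩ hab
    rw [mul_apply_removed hab hu]
    exact hv _ hab
  | inv u _ hu =>
    rintro ⟨a, b⟩ hab
    have h := mul_apply_removed (v := u⁻¹) hab hu
    have : a ≠ b := by
      rintro rfl
      have habr : (a, a) ∈ rootPos t n := by
        unfold removed at hab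
        split_ifs at hab <;> exact (Finset.mem_filter.1 hab).1
      simp [rootPos] at habr
    rw [mul_inv_cancel, toMat_one, Matrix.one_apply_ne this] at h
    exact h.symm

theorem entry_add {i j : Fin (size t n)} (hij : (i, j) ∈ rootPos t n) {u v : sylowU t n F}
    (hu : u ∈ elementarySubgroup F i j) (hv : v ∈ elementarySubgroup F i j) :
    toMat (u * v) i j = toMat u i j + toMat v i j := by
  have hu' := elementarySubgroup_removed hu
  have hv' := elementarySubgroup_removed (inv_mem hv)
  have hlt : i < j := by simp [rootPos] at hij; exact hij.1
  rw [toMat_mul, Matrix.mul_apply, Finset.sum_eq_add j i hlt.ne', toMat_diag, toMat_diag, mul_one,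
    one_mul]
  · rintro k _ ⟨hkj, hki⟩
    rcases lt_or_gt_of_ne hki with h | hik
    · rw [toMat_lower u h, zero_mul]
    rcases lt_or_gt_of_ne hkj with hkj | h
    swap
    · rw [toMat_lower v h, mul_zero]
    by_cases hcase : (i, k) ∈ removed i j
    · rw [hu' _ hcase, zero_mul]
    · have : (j.rev, k.rev) ∈ removed i j := by
        have hsize : (size t n = 2 * n + 1 ∧ nTilde t n = n + 1) ∨
            (size t n = 2 * n ∧ nTilde t n = n) := by
          unfold size nTilde
          split_ifs <;> simp
        have hk := k.2
        have hj := j.2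
        rw [Fin.lt_def] at hik hkj
        unfold removed at *
        split_ifs at * with hjn
        all_goals
          simp only [rootPos, Finset.mem_filter, Finset.mem_univ, true_and, Fin.lt_def,
            Fin.ext_iff, Fin.val_rev] at hij hcase ⊢
          have hle : (j : ℕ) ≤ size t n - (i + 1) := by
            rcases hij.2 with h | h
            · exact h.le
            · exact h.2.le
          have hk1 : (k : ℕ) < size t n - (i + 1) := by omega
        · exact absurd ⟨⟨hik, Or.inl hk1⟩, hkj⟩ hcase
        · have hkn : n ≤ (k : ℕ) := by
            by_contra hkn
            exact hcase ⟨⟨hik, Or.inl hk1⟩, Or.inl (by omega)⟩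
          exact ⟨⟨by omega, Or.inl (by omega)⟩, Or.inr (by omega)⟩
      rw [toMat_inv_rev v j k (hv' _ this), mul_zero]
  · simp
  · simp

/-- The linear character `χ^{i,j}_α : u ↦ θ(α u_{ij})` of `U_{i,j}`. -/
def linearCharacter (θ : AddChar F ℂ) {i j : Fin (size t n)} (hij : (i, j) ∈ rootPos t n) (α : F) :
    elementarySubgroup F i j →* ℂ where
  toFun u := θ (α * toMat (u : sylowU t n F) i j)
  map_one' := by
    have : i ≠ j := by rintro rfl; simp [rootPos] at hij
    simp [toMat_one, this]
  map_mul' u v := by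
    rw [Subgroup.coe_mul, entry_add hij u.2 v.2, mul_add, AddChar.map_add_eq_mul]

/-- The character of the finite group `G` induced from the linear character `χ` of the
subgroup `H`: `g ↦ |H|⁻¹ ∑ χ(x g x⁻¹)`, the sum over all `x ∈ G` with `x g x⁻¹ ∈ H`. -/
noncomputable def inducedCharacter {G : Type*} [Group G] [Finite G] (H : Subgroup G) (χ : H →* ℂ)
    (g : G) : ℂ :=
  letI := Fintype.ofFinite G
  open scoped Classical in
  (Nat.card H : ℂ)⁻¹ * ∑ x : G, if h : x * g * x⁻¹ ∈ H then χ ⟨x * g * x⁻¹, h⟩ else 0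

/-- The André–Neto elementary character `ξ^{i,j}_α`, induced from `χ^{i,j}_α` to `U`. -/
noncomputable def elementaryCharacter [Finite F] (θ : AddChar F ℂ) {i j : Fin (size t n)}
    (hij : (i, j) ∈ rootPos t n) (α : F) : sylowU t n F → ℂ :=
  inducedCharacter (elementarySubgroup F i j) (linearCharacter θ hij α)

end Roots

section Monomial

variable (t : DynkinType) (n : ℕ) (F : Type*) [Field F]

/-- The space `V` of all matrices supported in the root positions. -/
def rootSpace : Submodule F (Mat t n F) where
  carrier := {A | ∀ r s, (r, s) ∉ rootPos t n → A r s = 0}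
  add_mem' ha hb r s h := by simp [ha r s h, hb r s h]
  zero_mem' := by simp
  smul_mem' c a ha r s h := by simp [ha r s h]

variable {t n F}

/-- The natural projection `π` of the `N × N` matrices onto `V`. -/
def proj (X : Mat t n F) : rootSpace t n F :=
  ⟨Matrix.of fun r s => if (r, s) ∈ rootPos t n then X r s else 0, fun r s h => by simp [h]⟩

/-- The permutation action `[A].u = [π(A u⁻ᵗ)]` of `U` on `V̂ = {[A] | A ∈ V}`. -/
def dot (A : rootSpace t n F) (u : sylowU t n F) : rootSpace t n F :=
  proj ((A : Mat t n F) * (toMat u⁻¹)ᵀ)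

/-- The coefficient `θ(-κ(A, u⁻¹))` with `κ(A, B) = tr(Aᵗ B)`. -/
def coeff (θ : AddChar F ℂ) (A : rootSpace t n F) (u : sylowU t n F) : ℂ :=
  θ (-((A : Mat t n F)ᵀ * toMat u⁻¹).trace)

theorem dot_apply (A : rootSpace t n F) (u : sylowU t n F) {r s : Fin (size t n)}
    (h : (r, s) ∈ rootPos t n) :
    (dot A u : Mat t n F) r s = ((A : Mat t n F) * (toMat u⁻¹)ᵀ) r s := by
  simp [dot, proj, h]

theorem mul_transpose_apply_eq_zero (A : rootSpace t n F) (u : sylowU t n F)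
    {r s : Fin (size t n)} (h : (r, s) ∉ rootPos t n) (hrs : r < s) :
    ((A : Mat t n F) * (toMat u)ᵀ) r s = 0 := by
  rw [Matrix.mul_apply]
  refine Finset.sum_eq_zero fun k _ => ?_
  rcases lt_or_ge k s with hk | hk
  · rw [Matrix.transpose_apply, toMat_lower u hk, mul_zero]
  · rw [A.2 r k, zero_mul]
    intro hr
    apply h
    simp only [rootPos, Finset.mem_filter, Finset.mem_univ, true_and] at hr ⊢
    rcases hr with ⟨_, hr | hr⟩
    · exact ⟨hrs, Or.inl (hk.trans_lt hr)⟩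
    · rcases hk.lt_or_eq with h' | h'
      · exact ⟨hrs, Or.inl (h'.trans_eq hr.2)⟩
      · exact ⟨hrs, Or.inr ⟨hr.1, h'.trans hr.2⟩⟩

theorem dot_eq (A : rootSpace t n F) (u : sylowU t n F) {r s : Fin (size t n)} (h : r < s) :
    (dot A u : Mat t n F) r s = ((A : Mat t n F) * (toMat u⁻¹)ᵀ) r s := by
  by_cases hr : (r, s) ∈ rootPos t n
  · exact dot_apply A u hr
  · rw [(dot A u).2 r s hr, mul_transpose_apply_eq_zero A _ hr h]

theorem lt_of_mem_rootPos {r s : Fin (size t n)} (h : (r, s) ∈ rootPos t n) : r < s := by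
  simp only [rootPos, Finset.mem_filter] at h
  exact h.2.1

theorem rootSpace_ext {A B : rootSpace t n F}
    (h : ∀ r s, (r, s) ∈ rootPos t n → (A : Mat t n F) r s = (B : Mat t n F) r s) : A = B := by
  ext r s
  by_cases hr : (r, s) ∈ rootPos t n
  · exact h r s hr
  · rw [A.2 r s hr, B.2 r s hr]

theorem dot_one (A : rootSpace t n F) : dot A 1 = A := by
  refine rootSpace_ext fun r s h => ?_
  rw [dot_apply A 1 h, inv_one, toMat_one, Matrix.transpose_one, Matrix.mul_one]

theorem dot_mul (A : rootSpace t n F) (u v : sylowU t n F) : dot A (u * v) = dot (dot A u) v := by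
  refine rootSpace_ext fun r s h => ?_
  rw [dot_apply _ _ h, dot_apply _ _ h, mul_inv_rev, toMat_mul, Matrix.transpose_mul,
    ← Matrix.mul_assoc, Matrix.mul_apply, Matrix.mul_apply]
  refine Finset.sum_congr rfl fun k _ => ?_
  rcases lt_or_ge k s with hk | hk
  · rw [Matrix.transpose_apply, toMat_lower _ hk, mul_zero, mul_zero]
  · rw [dot_eq A u ((lt_of_mem_rootPos h).trans_le hk)]

theorem trace_dot (A : rootSpace t n F) (u v : sylowU t n F) :
    ((A : Mat t n F)ᵀ * toMat (u * v)⁻¹).trace =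
      ((A : Mat t n F)ᵀ * toMat u⁻¹).trace + ((dot A u : Mat t n F)ᵀ * toMat v⁻¹).trace := by
  have key : ∀ X Y : Mat t n F, (Xᵀ * Y).trace = ∑ r, ∑ s, X r s * Y r s := by
    intro X Y
    simp only [Matrix.trace, Matrix.diag_apply, Matrix.mul_apply, Matrix.transpose_apply]
    rw [Finset.sum_comm]
  have h1 : ((A : Mat t n F)ᵀ * toMat (u * v)⁻¹).trace =
      (((A : Mat t n F) * (toMat u⁻¹)ᵀ)ᵀ * toMat v⁻¹).trace := by
    rw [mul_inv_rev, toMat_mul, Matrix.transpose_mul, Matrix.transpose_transpose,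
      ← Matrix.mul_assoc, Matrix.trace_mul_comm, ← Matrix.mul_assoc]
  rw [h1, key, key, key, ← Finset.sum_add_distrib]
  refine Finset.sum_congr rfl fun r _ => ?_
  have hr : (r, r) ∉ rootPos t n := fun h => lt_irrefl _ (lt_of_mem_rootPos h)
  have h2 : ∀ s, ((A : Mat t n F) * (toMat u⁻¹)ᵀ) r s * toMat v⁻¹ r s =
      (if s = r then ((A : Mat t n F) * (toMat u⁻¹)ᵀ) r r else 0) +
        (dot A u : Mat t n F) r s * toMat v⁻¹ r s := by
    intro s
    rcases lt_trichotomy s r with h | h | h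
    · rw [toMat_lower _ h, if_neg h.ne]; simp
    · subst h
      rw [(dot A u).2 _ _ hr, if_pos rfl, toMat_diag]; simp
    · rw [if_neg h.ne', dot_eq A u h, zero_add]
  rw [Finset.sum_congr rfl fun s _ => h2 s, Finset.sum_add_distrib]
  simp [Matrix.mul_apply]

theorem coeff_mul (θ : AddChar F ℂ) (A : rootSpace t n F) (u v : sylowU t n F) :
    coeff θ A (u * v) = coeff θ A u * coeff θ (dot A u) v := by
  rw [coeff, coeff, coeff, trace_dot, neg_add, AddChar.map_add_eq_mul]

theorem coeff_one (θ : AddChar F ℂ) (A : rootSpace t n F) : coeff θ A 1 = 1 := by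
  have : ((A : Mat t n F)ᵀ * (1 : Mat t n F)).trace = 0 := by
    rw [Matrix.mul_one, Matrix.trace]
    exact Finset.sum_eq_zero fun r _ => A.2 r r fun h => lt_irrefl _ (lt_of_mem_rootPos h)
  rw [coeff, inv_one, toMat_one, this, neg_zero, AddChar.map_zero_eq_one]

/-- The right `ℂU`-module `ℂV̂`: it has the basis `[A] = Finsupp.single A 1`, `A ∈ V`, on which `U`
acts monomially from the right, `[A] u = θ(-κ(A, u⁻¹)) [A].u`. Right `ℂU`-modules are
representations of the opposite group of `U`. -/
noncomputable def monomialRep (θ : AddChar F ℂ) :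
    Representation ℂ (sylowU t n F)ᵐᵒᵖ (rootSpace t n F →₀ ℂ) where
  toFun u := Finsupp.linearCombination ℂ fun A =>
    Finsupp.single (dot A u.unop) (coeff θ A u.unop)
  map_one' := by
    ext A : 1
    ext
    simp [dot_one, coeff_one]
  map_mul' u v := by
    ext A : 1
    ext
    simp [dot_mul, coeff_mul]

/-- The submodule of `ℂV̂` with basis the `[A]`, `A ∈ s`, for a `U`-stable set `s`. -/
noncomputable def monomialSub (θ : AddChar F ℂ) (s : Set (rootSpace t n F))
    (hs : ∀ A ∈ s, ∀ u, dot A u ∈ s) : Subrepresentation (monomialRep (t := t) (n := n) θ) where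
  toSubmodule := Finsupp.supported ℂ ℂ s
  apply_mem_toSubmodule := by
    intro u x hx
    rw [monomialRep]
    change Finsupp.linearCombination ℂ _ x ∈ _
    rw [Finsupp.linearCombination_apply]
    refine Submodule.sum_mem _ fun A hA => Submodule.smul_mem _ _ ?_
    exact Finsupp.single_mem_supported ℂ _ (hs A (hx hA) _)

/-- The `U`-orbit `𝒪_A` of `[A]`. -/
def orbit (A : rootSpace t n F) : Set (rootSpace t n F) := Set.range (dot A)

/-- The orbit module `ℂ𝒪_A`. -/
noncomputable def orbitModule (θ : AddChar F ℂ) (A : rootSpace t n F) :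
    Subrepresentation (monomialRep (t := t) (n := n) θ) :=
  monomialSub θ (orbit A) (by
    rintro _ ⟨u, rfl⟩ v
    exact ⟨u * v, dot_mul A u v⟩)

/-- `(r, s)` is a main condition of `A`: `A_{rs}` is the rightmost nonzero entry of row `r`. -/
def IsMain (A : rootSpace t n F) (r s : Fin (size t n)) : Prop :=
  (A : Mat t n F) r s ≠ 0 ∧ ∀ k, s < k → (A : Mat t n F) r k = 0

open scoped Classical in
/-- The verge of `A`: all entries of `A` which are not at main conditions are replaced by `0`. -/
noncomputable def verge (A : rootSpace t n F) : Mat t n F :=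
  Matrix.of fun r s => if IsMain A r s then (A : Mat t n F) r s else 0

theorem dot_apply_of_right {A : rootSpace t n F} {r s : Fin (size t n)}
    (h : ∀ k, s < k → (A : Mat t n F) r k = 0) (u : sylowU t n F) :
    (dot A u : Mat t n F) r s = (A : Mat t n F) r s := by
  by_cases hr : (r, s) ∈ rootPos t n
  · rw [dot_apply A u hr, Matrix.mul_apply, Finset.sum_eq_single s]
    · rw [Matrix.transpose_apply, toMat_diag, mul_one]
    · intro k _ hk
      rcases lt_or_gt_of_ne hk with hk | hk
      · rw [Matrix.transpose_apply, toMat_lower _ hk, mul_zero]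
      · rw [h k hk, zero_mul]
    · simp
  · rw [(dot A u).2 r s hr, A.2 r s hr]

theorem dot_right_zero {A : rootSpace t n F} {r s : Fin (size t n)}
    (h : ∀ k, s < k → (A : Mat t n F) r k = 0) (u : sylowU t n F) :
    ∀ k, s < k → (dot A u : Mat t n F) r k = 0 := by
  intro k hk
  rw [dot_apply_of_right (fun l hl => h l (hk.trans hl)), h k hk]

theorem isMain_dot {A : rootSpace t n F} {r s : Fin (size t n)} (h : IsMain A r s)
    (u : sylowU t n F) : IsMain (dot A u) r s :=
  ⟨by rw [dot_apply_of_right h.2]; exact h.1, dot_right_zero h.2 u⟩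

theorem verge_dot (A : rootSpace t n F) (u : sylowU t n F) : verge (dot A u) = verge A := by
  ext r s
  simp only [verge, Matrix.of_apply]
  by_cases h : IsMain A r s
  · rw [if_pos h, if_pos (isMain_dot h u), dot_apply_of_right h.2]
  · rw [if_neg h, if_neg]
    intro h'
    apply h
    have := isMain_dot h' u⁻¹
    rwa [← dot_mul, mul_inv_cancel, dot_one] at this

/-- The module `ℂ𝒱(A)` with monomial basis `𝒱(A) = {[B] | verge(B) = verge(A)}`. -/
noncomputable def vergeModule (θ : AddChar F ℂ) (A : rootSpace t n F) :
    Subrepresentation (monomialRep (t := t) (n := n) θ) :=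
  monomialSub θ {B | verge B = verge A} fun B hB u => (verge_dot B u).trans hB

/-- The element `α e_{ij}` of `V`. -/
def rootElem {i j : Fin (size t n)} (hij : (i, j) ∈ rootPos t n) (α : F) : rootSpace t n F :=
  ⟨Matrix.single i j α, fun r s h => by
    rw [Matrix.single_apply, if_neg]
    rintro ⟨rfl, rfl⟩
    exact h hij⟩

theorem minor_mem_rootPos (ht : t ≠ .C) {i j : Fin (size t n)} (hij : (i, j) ∈ rightTriangle t n) :
    (i, j.rev) ∈ rootPos t n := by
  simp only [rightTriangle, rootPos, Finset.mem_filter, Finset.mem_univ, true_and, ht, false_and,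
    or_false, Fin.lt_def, Fin.val_rev] at hij ⊢
  have := j.2
  have := i.2
  cases t <;> simp [size, nTilde] at * <;> omega

/-- The element `A_β = β e_{i,j̄} + α e_{ij}` of `V`, for `(i, j)` in the right triangle in types
`𝔅ₙ` and `𝔇ₙ`. -/
def minorElem (ht : t ≠ .C) {i j : Fin (size t n)} (hij : (i, j) ∈ rightTriangle t n) (α β : F) :
    rootSpace t n F :=
  rootElem (minor_mem_rootPos ht hij) β + rootElem (Finset.mem_filter.1 hij).1 α

end Monomial

end ClassicalUnipotent

/-! Write H for U_{i,j}, χ for its linear character and q for the order of F. The module M is never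
constructed. Frobenius reciprocity turns maps M → W into χ-eigenvectors of H in W
(`finrank_intertwiningMap_eq_finrank_eigenvectors`). Moreover dim M = [U : H], which is at most
q^|ϱ| because a coset Hu is determined by the entries of u in ϱ (`mem_elementarySubgroup_iff`,
`card_sylowU_le`).

Let j < ī. The elements of 𝒱(A) have only row i, with α in column j and free entries in the columns
between i and j (`verge_eq_iff`). A group element with entry μ at (i,k), i < k < j, and its other
nontrivial entries in column ī fixes every such [B] up to the scalar θ(-μ B_ik). These scalars
separate the basis vectors (`exists_coeff_ne`), so invariant subspaces are spanned by basis vectors,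
orbit modules are irreducible, and disjoint orbits give non-isomorphic modules. Column operations
with the pivot α clear row i except in column j̄. In the left triangle there is no such column left
of j, and in type ℭ a long root element clears it, so 𝒱(A) is one orbit. In types 𝔅, 𝔇 the entry β
at j̄ survives, and the invariant quadratic form takes the value 2αβ on row i of A_β, so there are
exactly q orbits. Each orbit module contains a χ-eigenvector (`exists_eigenvector_orbitModule`),
hence receives a nonzero map from M. The sum of these maps is onto ℂ𝒱(A), and dim M ≤ |𝒱(A)| makes
it an isomorphism (`nonempty_equiv_vergeModule`).

Let j = ī in type ℭ. Two elements of H on which χ is trivial, a translation and a transvection, move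
[B] to the same basis vector with different scalars unless the right half of row i of B vanishes
left of ī. This leaves a single χ-eigenvector in ℂ𝒪_A up to scalars (`eq_smul_basisSum`), so the
multiplicity is 1. The image of any nonzero map M → ℂ𝒪_A contains this vector, and its translates
already span dim M dimensions (`card_pi_le_finrank`). So every nonzero map is injective, and
Maschke's theorem gives irreducibility. -/

namespace Representation

open Module

/-! ### Frobenius reciprocity for induced linear characters. -/

section Induced

variable {G V W : Type*} [Group G] [AddCommGroup V] [Module ℂ V] [AddCommGroup W] [Module ℂ W]

/-- The vectors of a right module on which the subgroup `H` acts through the linear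
character `χ`. -/
def eigenvectors (σ : Representation ℂ Gᵐᵒᵖ W) (H : Subgroup G) (χ : H →* ℂ) : Submodule ℂ W where
  carrier := {w | ∀ h : H, σ (MulOpposite.op (h : G)) w = χ h • w}
  add_mem' ha hb h := by rw [map_add, ha h, hb h, smul_add]
  zero_mem' h := by simp
  smul_mem' c a ha h := by rw [map_smul, ha h, smul_comm]

theorem mem_eigenvectors {σ : Representation ℂ Gᵐᵒᵖ W} {H : Subgroup G} {χ : H →* ℂ} {w : W} :
    w ∈ σ.eigenvectors H χ ↔ ∀ h : H, σ (MulOpposite.op (h : G)) w = χ h • w := Iff.rfl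

/-- The restriction of a right module to `H`, twisted by the inverse of the linear
character `χ`. -/
def twistedRestriction (σ : Representation ℂ Gᵐᵒᵖ W) (H : Subgroup G) (χ : H →* ℂ) :
    Representation ℂ Hᵐᵒᵖ W where
  toFun h := χ h.unop⁻¹ • σ (MulOpposite.op (h.unop : G))
  map_one' := by simp
  map_mul' a b := by
    ext w
    simp [mul_smul, smul_comm (χ a.unop)⁻¹]

theorem map_inv_mul_self {H : Type*} [Group H] (χ : H →* ℂ) (h : H) : χ h⁻¹ * χ h = 1 := by
  rw [← map_mul, inv_mul_cancel, map_one]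

theorem invariants_twistedRestriction (σ : Representation ℂ Gᵐᵒᵖ W) (H : Subgroup G)
    (χ : H →* ℂ) : (σ.twistedRestriction H χ).invariants = σ.eigenvectors H χ := by
  ext w
  rw [mem_invariants, mem_eigenvectors, MulOpposite.forall]
  refine forall_congr' fun h => ?_
  change χ h⁻¹ • σ (MulOpposite.op (h : G)) w = w ↔ _
  constructor <;> intro e
  · conv_rhs => rw [← e]
    rw [smul_smul, mul_comm, map_inv_mul_self, one_smul]
  · rw [e, smul_smul, map_inv_mul_self, one_smul]

variable [Finite G] [FiniteDimensional ℂ V] [FiniteDimensional ℂ W]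

/-- Frobenius reciprocity for a module which affords an induced linear character. -/
theorem finrank_intertwiningMap_eq_finrank_eigenvectors {H : Subgroup G} {χ : H →* ℂ}
    {ρ : Representation ℂ Gᵐᵒᵖ V}
    (hρ : ∀ g, ρ.character (MulOpposite.op g) = ClassicalUnipotent.inducedCharacter H χ g)
    (σ : Representation ℂ Gᵐᵒᵖ W) :
    finrank ℂ (ρ.IntertwiningMap σ) = finrank ℂ (σ.eigenvectors H χ) := by
  classical
  have hG : (Nat.card G : ℂ) ≠ 0 := Nat.cast_ne_zero.2 Nat.card_pos.ne'
  let _ : Fintype G := Fintype.ofFinite G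
  let _ : Fintype H := Fintype.ofFinite H
  let _ : Fintype Gᵐᵒᵖ := Fintype.ofEquiv G MulOpposite.opEquiv
  let _ : Fintype Hᵐᵒᵖ := Fintype.ofEquiv H MulOpposite.opEquiv
  let _ : Invertible (Nat.card Gᵐᵒᵖ : ℂ) := invertibleOfNonzero (Nat.cast_ne_zero.2 Nat.card_pos.ne')
  let _ : Invertible (Nat.card Hᵐᵒᵖ : ℂ) := invertibleOfNonzero (Nat.cast_ne_zero.2 Nat.card_pos.ne')
  have h1 := card_inv_mul_sum_char_mul_char_eq_finrank ρ σ
  have h2 := card_inv_mul_sum_char_eq_finrank (σ.twistedRestriction H χ)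
  rw [invariants_twistedRestriction] at h2
  rw [← Nat.cast_inj (R := ℂ), ← h1, ← h2]
  rw [← MulOpposite.opEquiv.sum_comp, ← MulOpposite.opEquiv.sum_comp,
    Nat.card_congr (MulOpposite.opEquiv (α := G)).symm,
    Nat.card_congr (MulOpposite.opEquiv (α := H)).symm]
  simp only [MulOpposite.opEquiv_apply, ← MulOpposite.op_inv, hρ,
    ClassicalUnipotent.inducedCharacter]
  -- D is χ extended by zero to G, so that all sums can run over G.
  let D : G → ℂ := fun g => if h : g ∈ H then χ ⟨g, h⟩ else 0
  -- The character of σ is a class function, so every x contributes the same amount; the resulting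
  -- factor |G| cancels the averaging over G.
  have e1 : ∀ x : G, ∑ g : G, σ.character (MulOpposite.op g) * D (x * g⁻¹ * x⁻¹) =
      ∑ g : G, σ.character (MulOpposite.op g) * D g⁻¹ := by
    intro x
    rw [← (MulAut.conj x⁻¹).toEquiv.sum_comp]
    refine Finset.sum_congr rfl fun g _ => ?_
    have h3 : MulOpposite.op (x⁻¹ * g * x) =
        MulOpposite.op x * MulOpposite.op g * (MulOpposite.op x)⁻¹ := by
      simp [mul_assoc]
    have h4 : x * (x⁻¹ * g * x)⁻¹ * x⁻¹ = g⁻¹ := by group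
    simp only [MulEquiv.toEquiv_eq_coe, EquivLike.coe_coe, MulAut.conj_apply, inv_inv, h3,
      char_conj, h4]
  have e2 : ∑ g : G, σ.character (MulOpposite.op g) * D g⁻¹ =
      ∑ h : H, (σ.twistedRestriction H χ).character (MulOpposite.op h) := by
    have h5 : ∀ h : H, (σ.twistedRestriction H χ).character (MulOpposite.op h) =
        σ.character (MulOpposite.op (h : G)) * D (h : G)⁻¹ := by
      intro h
      have : ((h : G)⁻¹) ∈ H := inv_mem h.2
      simp only [D, this, dif_pos]
      change LinearMap.trace ℂ W (χ h⁻¹ • σ (MulOpposite.op (h : G))) = _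
      rw [map_smul, smul_eq_mul, mul_comm]
      rfl
    refine (Fintype.sum_of_injective (Subtype.val : H → G) Subtype.val_injective _ _ ?_ h5).symm
    intro g hg
    have : g⁻¹ ∉ H := fun h => hg ⟨⟨g, inv_mem_iff.1 h⟩, rfl⟩
    simp [D, this]
  have e3 : ∑ g : G, σ.character (MulOpposite.op g) *
      ((Nat.card H : ℂ)⁻¹ * ∑ x : G, D (x * g⁻¹ * x⁻¹)) = Nat.card G * ((Nat.card H : ℂ)⁻¹ *
        ∑ h : H, (σ.twistedRestriction H χ).character (MulOpposite.op h)) := by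
    simp_rw [mul_left_comm (_ : ℂ) (Nat.card H : ℂ)⁻¹, Finset.mul_sum (_ : Finset G)]
    rw [Finset.sum_comm]
    simp_rw [← Finset.mul_sum, e1, e2]
    rw [Finset.sum_const, Finset.card_univ, ← Nat.card_eq_fintype_card, nsmul_eq_mul]
  refine (congrArg _ e3).trans ?_
  rw [inv_mul_cancel_left₀ hG]

theorem exists_intertwiningMap_ne_zero_iff {H : Subgroup G} {χ : H →* ℂ}
    {ρ : Representation ℂ Gᵐᵒᵖ V}
    (hρ : ∀ g, ρ.character (MulOpposite.op g) = ClassicalUnipotent.inducedCharacter H χ g)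
    (σ : Representation ℂ Gᵐᵒᵖ W) :
    (∃ f : ρ.IntertwiningMap σ, f ≠ 0) ↔ ∃ w ∈ σ.eigenvectors H χ, w ≠ 0 := by
  have h := finrank_intertwiningMap_eq_finrank_eigenvectors hρ σ
  constructor
  · rintro ⟨f, hf⟩
    have : Nontrivial (ρ.IntertwiningMap σ) := ⟨⟨f, 0, hf⟩⟩
    have h1 : 0 < finrank ℂ (σ.eigenvectors H χ) := h ▸ finrank_pos
    obtain ⟨w, hw⟩ := (finrank_pos_iff_exists_ne_zero (R := ℂ)).1 h1
    exact ⟨w, w.2, fun h => hw (Subtype.ext h)⟩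
  · rintro ⟨w, hw, hw0⟩
    have : Nontrivial (σ.eigenvectors H χ) := ⟨⟨⟨w, hw⟩, 0, fun h => hw0 (congrArg Subtype.val h)⟩⟩
    have h1 : 0 < finrank ℂ (ρ.IntertwiningMap σ) := h ▸ finrank_pos
    exact (finrank_pos_iff_exists_ne_zero (R := ℂ)).1 h1

theorem finrank_intertwiningMap_eq_one {H : Subgroup G} {χ : H →* ℂ} {ρ : Representation ℂ Gᵐᵒᵖ V}
    (hρ : ∀ g, ρ.character (MulOpposite.op g) = ClassicalUnipotent.inducedCharacter H χ g)
    {σ : Representation ℂ Gᵐᵒᵖ W} {x : W} (hx : x ∈ σ.eigenvectors H χ) (hx0 : x ≠ 0)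
    (h : ∀ y ∈ σ.eigenvectors H χ, ∃ c : ℂ, c • x = y) :
    finrank ℂ (ρ.IntertwiningMap σ) = 1 := by
  rw [finrank_intertwiningMap_eq_finrank_eigenvectors hρ,
    finrank_eq_one_iff_of_nonzero' ⟨x, hx⟩ fun h => hx0 (congrArg Subtype.val h)]
  intro y
  obtain ⟨c, hc⟩ := h y y.2
  exact ⟨c, Subtype.ext hc⟩

/-- The induced character at 1 is |G| / |H|: all summands are 1. -/
theorem card_mul_finrank_eq_card {H : Subgroup G} {χ : H →* ℂ} {ρ : Representation ℂ Gᵐᵒᵖ V}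
    (hρ : ∀ g, ρ.character (MulOpposite.op g) = ClassicalUnipotent.inducedCharacter H χ g) :
    Nat.card H * finrank ℂ V = Nat.card G := by
  have hH : (Nat.card H : ℂ) ≠ 0 := Nat.cast_ne_zero.2 Nat.card_pos.ne'
  have h := hρ 1
  have h1 : (⟨1, one_mem H⟩ : H) = 1 := rfl
  simp only [MulOpposite.op_one, char_one, ClassicalUnipotent.inducedCharacter, mul_one,
    mul_inv_cancel, one_mem, dif_pos, h1, map_one, Finset.sum_const, nsmul_eq_mul] at h
  rw [← Nat.cast_inj (R := ℂ), Nat.cast_mul, h, mul_inv_cancel_left₀ hH]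
  rw [@Finset.card_univ G (Fintype.ofFinite G), @Nat.card_eq_fintype_card G (Fintype.ofFinite G)]

end Induced

/-! ### Irreducibility in terms of invariant subspaces. -/

section Irreducible

variable {G k V W : Type*} [Monoid G] [Field k] [AddCommGroup V] [Module k V] [AddCommGroup W]
  [Module k W] {ρ : Representation k G V} {σ : Representation k G W}

theorem isIrreducible_of_forall_submodule [Nontrivial V]
    (h : ∀ P : Submodule k V, (∀ g, ∀ x ∈ P, ρ g x ∈ P) → P = ⊥ ∨ P = ⊤) : ρ.IsIrreducible where
  exists_pair_ne := by
    refine ⟨⊥, ⊤, fun h => bot_ne_top (α := Submodule k V) ?_⟩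
    exact congrArg Subrepresentation.toSubmodule h
  eq_bot_or_eq_top P := by
    rcases h P.toSubmodule fun g x hx => P.apply_mem_toSubmodule g hx with h | h
    · exact Or.inl (Subrepresentation.toSubmodule_injective h)
    · exact Or.inr (Subrepresentation.toSubmodule_injective h)

theorem IsIrreducible.eq_bot_or_eq_top [hρ : ρ.IsIrreducible] (P : Submodule k V)
    (hP : ∀ g, ∀ x ∈ P, ρ g x ∈ P) : P = ⊥ ∨ P = ⊤ := by
  rcases IsSimpleOrder.eq_bot_or_eq_top (⟨P, fun g _ hx => hP g _ hx⟩ : Subrepresentation ρ) with h | h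
  · exact Or.inl (congrArg Subrepresentation.toSubmodule h)
  · exact Or.inr (congrArg Subrepresentation.toSubmodule h)

theorem IsIrreducible.nontrivial (hρ : ρ.IsIrreducible) : Nontrivial V := by
  by_contra h
  rw [not_nontrivial_iff_subsingleton] at h
  obtain ⟨P, Q, hPQ⟩ := hρ.exists_pair_ne
  exact hPQ (Subrepresentation.toSubmodule_injective (Subsingleton.elim _ _))

theorem IsIrreducible.of_equiv (e : ρ.Equiv σ) (hσ : σ.IsIrreducible) : ρ.IsIrreducible := by
  have := hσ.nontrivial
  have : Nontrivial V := e.toLinearEquiv.toEquiv.nontrivial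
  refine isIrreducible_of_forall_submodule fun P hP => ?_
  have h := IsIrreducible.eq_bot_or_eq_top (ρ := σ) (P.map e.toLinearEquiv.toLinearMap) (by
    rintro g _ ⟨x, hx, rfl⟩
    exact ⟨ρ g x, hP g x hx, IntertwiningMap.isIntertwining ρ σ e.toIntertwiningMap g x⟩)
  rcases h with h | h
  · exact Or.inl (Submodule.map_eq_bot_iff.1 h)
  · refine Or.inr (eq_top_iff.2 fun x _ => ?_)
    obtain ⟨y, hy, hxy⟩ := (h ▸ Submodule.mem_top :
      e.toLinearEquiv x ∈ P.map e.toLinearEquiv.toLinearMap)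
    rwa [← e.toLinearEquiv.injective hxy]

end Irreducible

/-! ### An irreducibility criterion from Maschke's theorem. -/

section Maschke

variable {G V W : Type*} [Group G] [Finite G] [AddCommGroup V] [Module ℂ V] [AddCommGroup W]
  [Module ℂ W] {ρ : Representation ℂ G V} {σ : Representation ℂ G W}

theorem exists_isCompl_invariant (P : Submodule ℂ V) (hP : ∀ g, ∀ x ∈ P, ρ g x ∈ P) :
    ∃ Q : Submodule ℂ V, (∀ g, ∀ x ∈ Q, ρ g x ∈ Q) ∧ IsCompl P Q := by
  have : NeZero (Nat.card G : ℂ) := ⟨Nat.cast_ne_zero.2 Nat.card_pos.ne'⟩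
  have : IsSemisimpleRepresentation ρ := inferInstance
  obtain ⟨Q, hQ⟩ := exists_isCompl (⟨P, fun g _ hx => hP g _ hx⟩ : Subrepresentation ρ)
  refine ⟨Q.toSubmodule, fun g x hx => Q.apply_mem_toSubmodule g hx, ?_, ?_⟩
  · rw [disjoint_iff]
    exact congrArg Subrepresentation.toSubmodule hQ.inf_eq_bot
  · rw [codisjoint_iff]
    exact congrArg Subrepresentation.toSubmodule hQ.sup_eq_top

/-- For an invariant decomposition P ⊕ Q, compose f with the projection onto P. If the result is
nonzero, it is injective but kills Q, so Q = 0. If it is zero, the injective map f kills P, so P =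
0. -/
theorem isIrreducible_of_forall_injective (hex : ∃ f : ρ.IntertwiningMap σ, f ≠ 0)
    (hinj : ∀ f : ρ.IntertwiningMap σ, f ≠ 0 → Function.Injective f) : ρ.IsIrreducible := by
  obtain ⟨f, hf⟩ := hex
  have : Nontrivial V := by
    by_contra h
    rw [not_nontrivial_iff_subsingleton] at h
    exact hf (IntertwiningMap.ext (Subsingleton.elim _ _))
  refine isIrreducible_of_forall_submodule fun P hP => ?_
  obtain ⟨Q, hQ, hPQ⟩ := exists_isCompl_invariant P hP
  have hcomm : ∀ g x, P.projection Q hPQ (ρ g x) = ρ g (P.projection Q hPQ x) := by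
    intro g x
    have h1 : x = P.projection Q hPQ x + (x - P.projection Q hPQ x) := by abel
    conv_lhs => rw [h1]
    rw [map_add, map_add, Submodule.projection_apply_of_mem_left hPQ
      (hP g _ (Submodule.projection_apply_mem hPQ x)),
      (Submodule.projection_apply_eq_zero_iff hPQ).2
        (hQ g _ (Submodule.sub_projection_mem hPQ x)), add_zero]
  let p : ρ.IntertwiningMap σ := f.comp ⟨P.projection Q hPQ, fun g => LinearMap.ext (hcomm g)⟩
  have hp : ∀ x, p x = f (P.projection Q hPQ x) := fun x => rfl
  by_cases h : p = 0
  · refine Or.inl ((Submodule.eq_bot_iff P).2 fun x hx => hinj f hf ?_)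
    have h1 := hp x
    rw [h, Submodule.projection_apply_of_mem_left hPQ hx] at h1
    rw [← h1, map_zero]
    rfl
  · have hQ0 : Q = ⊥ := (Submodule.eq_bot_iff Q).2 fun x hx => hinj p h (by
      rw [hp, (Submodule.projection_apply_eq_zero_iff hPQ).2 hx, map_zero, map_zero])
    rw [hQ0] at hPQ
    exact Or.inr (by rw [← hPQ.sup_eq_top, sup_bot_eq])

end Maschke

end Representation

namespace ClassicalUnipotent

/-! ### Explicit elements of U. -/

section Elements

variable {t : DynkinType} {n : ℕ} {F : Type*} [Field F]

theorem formSign_mul_self (a : Fin (size t n)) : formSign t n F a * formSign t n F a = 1 := by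
  unfold formSign; split_ifs <;> simp

theorem formSign_ne_zero (a : Fin (size t n)) : formSign t n F a ≠ 0 := by
  unfold formSign; split_ifs <;> simp

theorem formSign_of_ne (ht : t ≠ .C) (a : Fin (size t n)) : formSign t n F a = 1 := by
  simp [formSign, ht]

theorem formSign_rev (ht : t = .C) (a : Fin (size t n)) :
    formSign t n F a.rev = -formSign t n F a := by
  subst ht
  have := a.2
  have h : size .C n = 2 * n := by simp [size]
  have h2 : (a.rev : ℕ) = 2 * n - (a + 1) := by
    rw [Fin.val_rev]; omega
  unfold formSign
  rw [h2]
  by_cases h1 : n ≤ (a : ℕ)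
  · rw [if_neg (by omega), if_pos ⟨rfl, h1⟩, neg_neg]
  · rw [if_pos ⟨rfl, by omega⟩, if_neg (by tauto)]

theorem formSign_rev_mul_rev (a b : Fin (size t n)) :
    formSign t n F a.rev * formSign t n F b.rev = formSign t n F a * formSign t n F b := by
  by_cases ht : t = .C
  · rw [formSign_rev ht, formSign_rev ht, neg_mul_neg]
  · simp [formSign_of_ne ht]

theorem single_mul_single_of_ne {a b c d : Fin (size t n)} (h : b ≠ c) {x y : F} :
    Matrix.single a b x * Matrix.single c d y = 0 := by
  simp [h]

theorem gram_mul_single (a b : Fin (size t n)) (c : F) :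
    gram t n F * Matrix.single a b c = Matrix.single a.rev b (formSign t n F a.rev * c) := by
  ext k l
  by_cases hl : l = b
  · subst hl
    rw [Matrix.mul_single_apply_same]
    by_cases hk : k = a.rev
    · subst hk; simp [gram]
    · have : a ≠ k.rev := fun h => hk (by rw [h, Fin.rev_rev])
      simp [gram, this, Ne.symm hk]
  · rw [Matrix.mul_single_apply_of_ne _ _ _ _ _ hl, Matrix.single_apply, if_neg]
    rintro ⟨_, rfl⟩; exact hl rfl

theorem single_mul_gram (a b : Fin (size t n)) (c : F) :
    Matrix.single a b c * gram t n F = Matrix.single a b.rev (c * formSign t n F b) := by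
  ext k l
  by_cases hk : k = a
  · subst hk
    rw [Matrix.single_mul_apply_same]
    by_cases hl : l = b.rev
    · subst hl; simp [gram]
    · simp [gram, hl, Ne.symm hl]
  · rw [Matrix.single_mul_apply_of_ne _ _ _ _ _ hk, Matrix.single_apply, if_neg]
    rintro ⟨rfl, _⟩; exact hk rfl

/-- An upper unitriangular matrix which preserves the form is an element of `U`. -/
theorem exists_toMat_eq (X : Mat t n F) (h0 : ∀ a b, b < a → X a b = 0) (h1 : ∀ a, X a a = 1)
    (hX : Xᵀ * gram t n F * X = gram t n F) : ∃ u : sylowU t n F, toMat u = X := by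
  have hdet : X.det = 1 := by
    rw [Matrix.det_of_isUpperTriangular fun a b h => h0 a b h]
    simp [h1]
  exact ⟨⟨Matrix.GeneralLinearGroup.mkOfDetNeZero X (by simp [hdet]), hX, h0, h1⟩, rfl⟩

theorem transpose_mul_gram_mul (u : sylowU t n F) :
    (toMat u)ᵀ * gram t n F * toMat u = gram t n F := u.2.1

theorem toMat_mul_toMat_inv (u : sylowU t n F) : toMat u * toMat u⁻¹ = 1 := by
  rw [← toMat_mul, mul_inv_cancel, toMat_one]

theorem toMat_injective : Function.Injective (toMat (t := t) (n := n) (F := F)) :=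
  fun _ _ h => Subtype.ext (Units.ext h)

theorem form_one_add (X : Mat t n F)
    (h : Xᵀ * gram t n F + gram t n F * X + Xᵀ * (gram t n F * X) = 0) :
    (1 + X)ᵀ * gram t n F * (1 + X) = gram t n F := by
  rw [Matrix.transpose_add, Matrix.transpose_one, Matrix.add_mul, Matrix.one_mul, Matrix.mul_add,
    Matrix.mul_one, Matrix.add_mul, Matrix.mul_assoc]
  rw [← sub_eq_zero, ← h]
  abel

/-- The short root elements, in a form which is symmetric under the reflection in the
antidiagonal. -/
theorem exists_toMat_short {a b : Fin (size t n)} (hab : a < b)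
    (ha : a ≠ a.rev) (hb : b ≠ b.rev) (μ : F) :
    ∃ u : sylowU t n F, toMat u = 1 + (Matrix.single a b μ -
      Matrix.single b.rev a.rev (formSign t n F a * formSign t n F b * μ)) := by
  have hr : b.rev < a.rev := Fin.rev_lt_rev.2 hab
  refine exists_toMat_eq _ (fun k l h => ?_) (fun k => ?_) (form_one_add _ ?_)
  · have h1 : ¬ (a = k ∧ b = l) := by rintro ⟨rfl, rfl⟩; exact lt_asymm h hab
    have h2 : ¬ (b.rev = k ∧ a.rev = l) := by rintro ⟨rfl, rfl⟩; exact lt_asymm h hr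
    simp [h.ne', h1, h2]
  · have h1 : ¬ (a = k ∧ b = k) := by rintro ⟨rfl, rfl⟩; exact lt_irrefl _ hab
    have h2 : ¬ (b.rev = k ∧ a.rev = k) := by rintro ⟨rfl, h⟩; exact hr.ne' h
    simp [h1, h2]
  · have e1 : formSign t n F b.rev * (formSign t n F a * formSign t n F b) =
        formSign t n F a.rev := by
      rw [← formSign_rev_mul_rev, mul_comm, mul_assoc, formSign_mul_self, mul_one]
    have e2 : formSign t n F b * (formSign t n F a * formSign t n F b) =
        formSign t n F a := by
      rw [mul_comm, mul_assoc, formSign_mul_self, mul_one]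
    simp only [Matrix.transpose_sub, Matrix.transpose_single, Matrix.sub_mul, Matrix.mul_sub,
      gram_mul_single, single_mul_gram, Fin.rev_rev]
    -- The quadratic term vanishes product by product; the assumptions that a and b are not their
    -- own mirrors exclude the two products not already excluded by a < b. The linear terms cancel
    -- by the choice of sign.
    rw [single_mul_single_of_ne ha, single_mul_single_of_ne hab.ne,
      single_mul_single_of_ne hr.ne, single_mul_single_of_ne hb.symm]
    have e3 : formSign t n F a * formSign t n F b * μ * formSign t n F b.rev =
        formSign t n F a.rev * μ := by rw [← e1]; ring
    have e4 : formSign t n F b * (formSign t n F a * formSign t n F b * μ) =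
        μ * formSign t n F a := by rw [← mul_assoc, e2, mul_comm]
    rw [e3, e4]
    abel

/-- The long root elements in type `ℭₙ`. -/
theorem exists_toMat_long (ht : t = .C) {a : Fin (size t n)} (ha : a < a.rev) (μ : F) :
    ∃ u : sylowU t n F, toMat u = 1 + Matrix.single a a.rev μ := by
  refine exists_toMat_eq _ (fun k l h => ?_) (fun k => ?_) (form_one_add _ ?_)
  · have h1 : ¬ (a = k ∧ a.rev = l) := by rintro ⟨rfl, rfl⟩; exact lt_asymm h ha
    simp [h.ne', h1]
  · have h1 : ¬ (a = k ∧ a.rev = k) := by rintro ⟨rfl, h⟩; exact ha.ne' h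
    simp [h1]
  · simp only [Matrix.transpose_single, gram_mul_single, single_mul_gram]
    rw [single_mul_single_of_ne ha.ne, add_zero, ← Matrix.single_add,
      formSign_rev ht, mul_comm]
    simp

/-- The root elements for the middle column in type `𝔅ₙ`. -/
theorem exists_toMat_middle (ht : t = .B) (hF : (2 : F) ≠ 0) {a b : Fin (size t n)} (hab : a < b)
    (hb : b = b.rev) (μ : F) :
    ∃ u : sylowU t n F, toMat u = 1 + (Matrix.single a b μ - Matrix.single b a.rev μ -
      Matrix.single a a.rev (μ ^ 2 / 2)) := by
  have hr : b < a.rev := by rw [hb]; exact Fin.rev_lt_rev.2 hab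
  have hε : ∀ k, formSign t n F k = 1 := formSign_of_ne (by rw [ht]; decide)
  refine exists_toMat_eq _ (fun k l h => ?_) (fun k => ?_) (form_one_add _ ?_)
  · have h1 : ¬ (a = k ∧ b = l) := by rintro ⟨rfl, rfl⟩; exact lt_asymm h hab
    have h2 : ¬ (b = k ∧ a.rev = l) := by rintro ⟨rfl, rfl⟩; exact lt_asymm h hr
    have h3 : ¬ (a = k ∧ a.rev = l) := by rintro ⟨rfl, rfl⟩; exact lt_asymm h (hab.trans hr)
    simp [h.ne', h1, h2, h3]
  · have h1 : ¬ (a = k ∧ b = k) := by rintro ⟨rfl, rfl⟩; exact lt_irrefl _ hab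
    have h2 : ¬ (b = k ∧ a.rev = k) := by rintro ⟨rfl, h⟩; exact hr.ne' h
    have h3 : ¬ (a = k ∧ a.rev = k) := by rintro ⟨rfl, h⟩; exact (hab.trans hr).ne' h
    simp [h1, h2, h3]
  · simp only [Matrix.transpose_sub, Matrix.transpose_single, Matrix.sub_mul, Matrix.mul_sub,
      gram_mul_single, single_mul_gram, hε, one_mul, mul_one, ← hb]
    rw [single_mul_single_of_ne (hab.trans hr).ne,
      single_mul_single_of_ne hab.ne,
      single_mul_single_of_ne (hab.trans hr).ne,
      single_mul_single_of_ne hr.ne,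
      Matrix.single_mul_single_same,
      single_mul_single_of_ne hr.ne,
      single_mul_single_of_ne (hab.trans hr).ne,
      single_mul_single_of_ne hab.ne,
      single_mul_single_of_ne (hab.trans hr).ne]
    -- This is the only surviving quadratic term. The corner entry -μ²/2 enters both linear terms
    -- and so cancels it.
    have : Matrix.single a.rev a.rev (μ * μ) = Matrix.single a.rev a.rev (μ ^ 2 / 2) +
        Matrix.single a.rev a.rev (μ ^ 2 / 2) := by
      rw [← Matrix.single_add]; congr 1; field_simp; ring
    rw [this]
    abel

end Elements

/-! ### Describing U_{i,j} by vanishing entries. -/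

section Generation

variable {t : DynkinType} {n : ℕ} {F : Type*} [Field F]

theorem eq_B_of_eq_rev {a : Fin (size t n)} (h : a = a.rev) : t = .B := by
  have h1 := congrArg Fin.val h
  rw [Fin.val_rev] at h1
  have := a.2
  cases t <;> simp [size] at * <;> omega

theorem mem_rootPos {r s : Fin (size t n)} :
    (r, s) ∈ rootPos t n ↔ r < s ∧ (s < r.rev ∨ (t = .C ∧ s = r.rev)) := by
  simp [rootPos]

theorem lt_rev_of_mem_rootPos {r s : Fin (size t n)} (h : (r, s) ∈ rootPos t n) : r < r.rev := by
  rcases mem_rootPos.1 h with ⟨h1, h2 | ⟨_, rfl⟩⟩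
  · exact h1.trans h2
  · exact h1

/-- The reflected entries of the inverse of an element of `U`. -/
theorem formSign_mul_toMat (u : sylowU t n F) (a b : Fin (size t n)) :
    formSign t n F b * toMat u b a = formSign t n F a * toMat u⁻¹ a.rev b.rev := by
  have h3 : (toMat u)ᵀ * gram t n F = gram t n F * toMat u⁻¹ := by
    calc _ = (toMat u)ᵀ * gram t n F * (toMat u * toMat u⁻¹) := by
          rw [toMat_mul_toMat_inv, Matrix.mul_one]
      _ = _ := by rw [← Matrix.mul_assoc, transpose_mul_gram_mul]
  have h4 := congrFun (congrFun h3 a) b.rev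
  rw [Matrix.mul_apply, Matrix.mul_apply, Finset.sum_eq_single b, Finset.sum_eq_single a.rev] at h4
  · simpa [gram, mul_comm] using h4
  · intro k _ hk
    simp [gram, hk]
  · simp
  · intro k _ hk
    have : b.rev ≠ k.rev := fun h => hk (Fin.rev_injective h).symm
    simp [gram, this]
  · simp

theorem toMat_eq_zero_iff (u : sylowU t n F) (a b : Fin (size t n)) :
    toMat u b a = 0 ↔ toMat u⁻¹ a.rev b.rev = 0 := by
  have h := formSign_mul_toMat u a b
  constructor <;> intro h0 <;> rw [h0, mul_zero] at h
  · exact (mul_eq_zero.1 h.symm).resolve_left (formSign_ne_zero a)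
  · exact (mul_eq_zero.1 h).resolve_left (formSign_ne_zero b)

/-- An element of `U` is determined by its entries in the root positions. -/
theorem eq_one_of_rootPos (hF : (2 : F) ≠ 0) {u : sylowU t n F}
    (hu : ∀ r s, (r, s) ∈ rootPos t n → toMat u r s = 0) : u = 1 := by
  -- Induction on the row, from the top. A position beyond the antidiagonal reflects to row s̄ < r
  -- of u⁻¹, which is trivial because that row of u is. On the antidiagonal in types 𝔅, 𝔇,
  -- reflection together with u u⁻¹ = 1 gives 2 u_{r r̄} = 0.
  have key : ∀ m : ℕ, ∀ r s : Fin (size t n), (r : ℕ) = m → r < s → toMat u r s = 0 := by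
    intro m
    induction m using Nat.strong_induction_on with
    | _ m ih =>
      rintro r s rfl hrs
      by_cases h1 : (r, s) ∈ rootPos t n
      · exact hu r s h1
      rw [mem_rootPos] at h1
      push Not at h1
      obtain ⟨h2, h3⟩ := h1 hrs
      rcases h2.lt_or_eq with h4 | rfl
      · have hsr : s.rev < r := by rw [← Fin.rev_rev r]; exact Fin.rev_lt_rev.2 h4
        rw [toMat_eq_zero_iff]
        have h5 := congrFun (congrFun (toMat_mul_toMat_inv u) s.rev) r.rev
        rw [Matrix.mul_apply, Finset.sum_eq_single s.rev, toMat_diag, one_mul,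
          Matrix.one_apply_ne (Fin.rev_lt_rev.2 hrs).ne] at h5
        · exact h5
        · intro k _ hk
          rcases lt_or_gt_of_ne hk with hk | hk
          · rw [toMat_lower u hk, zero_mul]
          · rw [ih _ hsr s.rev k rfl hk, zero_mul]
        · simp
      · have ht : t ≠ .C := fun h => h3 h rfl
        have h5 := congrFun (congrFun (toMat_mul_toMat_inv u) r) r.rev
        rw [Matrix.mul_apply, Finset.sum_eq_add r r.rev hrs.ne, toMat_diag, toMat_diag, one_mul,
          mul_one, Matrix.one_apply_ne hrs.ne] at h5
        · have h6 := formSign_mul_toMat u r.rev r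
          rw [formSign_of_ne ht, formSign_of_ne ht, Fin.rev_rev] at h6
          have h7 : 2 * toMat u r r.rev = 0 := by linear_combination h5 + h6
          exact (mul_eq_zero.1 h7).resolve_left hF
        · rintro k _ ⟨hk, hk'⟩
          rcases lt_or_gt_of_ne hk with hk | hk
          · rw [toMat_lower u hk, zero_mul]
          · rcases lt_or_gt_of_ne hk' with hk' | hk'
            · rw [hu r k (mem_rootPos.2 ⟨hk, Or.inl hk'⟩), zero_mul]
            · rw [toMat_lower _ hk', mul_zero]
        · simp
        · simp
  apply toMat_injective
  ext r s
  rw [toMat_one]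
  rcases lt_trichotomy r s with h | rfl | h
  · rw [key _ r s rfl h, Matrix.one_apply_ne h.ne]
  · rw [toMat_diag, Matrix.one_apply_eq]
  · rw [toMat_lower u h, Matrix.one_apply_ne h.ne']

/-- Elements of `U` with one prescribed entry above the diagonal and few other nontrivial
entries. -/
theorem exists_toMat_apply_eq (hF : (2 : F) ≠ 0) {a b : Fin (size t n)} (hab : a < b)
    (h : b ≠ a.rev ∨ t = .C) (μ : F) :
    ∃ v : sylowU t n F, toMat v a b = μ ∧
      (b ≠ b.rev → ∀ r l, (r, l) ≠ (a, b) → r ≠ b.rev →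
        toMat v r l = (1 : Mat t n F) r l) ∧
      (a ≠ a.rev → ∀ r l, (r, l) ≠ (a, b) → l ≠ a.rev →
        toMat v r l = (1 : Mat t n F) r l) := by
  have hr : b.rev < a.rev := Fin.rev_lt_rev.2 hab
  by_cases hb : b = b.rev
  · obtain ⟨v, hv⟩ := exists_toMat_middle (eq_B_of_eq_rev hb) hF hab hb μ
    have h1 : a.rev ≠ b := by rw [hb]; exact hr.ne'
    refine ⟨v, ?_, fun h => absurd hb h, fun _ r l hrl hl => ?_⟩
    · simp [hv, hab.ne, h1]
    · have h2 : ¬ (a = r ∧ b = l) := by rintro ⟨rfl, rfl⟩; exact hrl rfl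
      simp [hv, h2, hl.symm]
  by_cases ha : a = a.rev
  · have hba : b.rev < a := by rw [ha]; exact hr
    obtain ⟨v, hv⟩ := exists_toMat_middle (eq_B_of_eq_rev ha) hF hba ha (-μ)
    refine ⟨v, ?_, fun _ r l hrl hr => ?_, fun h => absurd ha h⟩
    · simp [hv, hab.ne, hba.ne]
    · have h2 : ¬ (a = r ∧ b = l) := by rintro ⟨rfl, rfl⟩; exact hrl rfl
      simp [hv, h2, hr.symm]
  by_cases hba : b = a.rev
  · subst hba
    obtain ⟨v, hv⟩ := exists_toMat_long (h.resolve_left fun h => h rfl) hab μ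
    refine ⟨v, ?_, fun _ r l hrl hr => ?_, fun _ r l hrl hl => ?_⟩
    · simp [hv, hab.ne]
    · have h2 : ¬ (a = r ∧ a.rev = l) := by rintro ⟨rfl, rfl⟩; exact hrl rfl
      simp [hv, h2]
    · simp [hv, hl.symm]
  · obtain ⟨v, hv⟩ := exists_toMat_short hab ha hb μ
    refine ⟨v, ?_, fun _ r l hrl hr => ?_, fun _ r l hrl hl => ?_⟩
    · simp [hv, hab.ne, Ne.symm hba]
    · have h2 : ¬ (a = r ∧ b = l) := by rintro ⟨rfl, rfl⟩; exact hrl rfl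
      simp [hv, h2, hr.symm]
    · have h2 : ¬ (a = r ∧ b = l) := by rintro ⟨rfl, rfl⟩; exact hrl rfl
      simp [hv, h2, hl.symm]

theorem val_eq_of_eq_B (ht : t = .B) {s : Fin (size t n)} : (s : ℕ) = n ↔ s = s.rev := by
  subst ht
  have := s.2
  rw [Fin.ext_iff, Fin.val_rev]
  simp [size] at *
  omega

theorem val_lt_of_lt_rev (ht : t = .C) {r : Fin (size t n)} (h : r < r.rev) : (r : ℕ) < n := by
  subst ht
  have := r.2
  rw [Fin.lt_def, Fin.val_rev] at h
  simp [size] at *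
  omega

theorem exists_toMat_eq_rootMatrix (hF : (2 : F) ≠ 0) {r s : Fin (size t n)}
    (h : (r, s) ∈ rootPos t n) (μ : F) : ∃ u : sylowU t n F, toMat u = rootMatrix r s μ := by
  have hrs := lt_of_mem_rootPos h
  have hr := lt_rev_of_mem_rootPos h
  unfold rootMatrix
  split_ifs with c1 c2 c3
  · obtain ⟨u, hu⟩ := exists_toMat_middle c1.1 hF hrs ((val_eq_of_eq_B c1.1).1 c1.2) μ
    exact ⟨u, by rw [hu]; abel⟩
  · obtain ⟨rfl, rfl⟩ := c2
    exact exists_toMat_long rfl hr μ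
  · have hs : s ≠ s.rev := fun h => by simpa [c3.1] using eq_B_of_eq_rev h
    obtain ⟨u, hu⟩ := exists_toMat_short hrs hr.ne hs μ
    have h1 : formSign t n F r = 1 := by
      have := val_lt_of_lt_rev c3.1 hr
      simp [formSign]; omega
    have h2 : formSign t n F s = -1 := by simp [formSign, c3]
    refine ⟨u, ?_⟩
    rw [hu, h1, h2, one_mul, neg_one_mul, ← Matrix.single_neg, sub_neg_eq_add, add_assoc]
  · have hs : s ≠ s.rev := fun h =>
      c1 ⟨eq_B_of_eq_rev h, (val_eq_of_eq_B (eq_B_of_eq_rev h)).2 h⟩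
    obtain ⟨u, hu⟩ := exists_toMat_short hrs hr.ne hs μ
    have h2 : formSign t n F s = 1 := by simp only [formSign, c3, if_false]
    have h1 : formSign t n F r = 1 := by
      rw [formSign, if_neg]
      rintro ⟨ht, h⟩
      have : (r : ℕ) < s := hrs
      exact c3 ⟨ht, by omega⟩
    refine ⟨u, ?_⟩
    rw [hu, h1, h2, one_mul, one_mul, add_sub_assoc]

/-- A common shape for all four kinds of root elements, so that one elimination computation serves
all types: apart from (r,s), only the reflected position and the corner (r, r̄) can occur, and
neither occurs for a long root. -/
theorem rootMatrix_eq {r s : Fin (size t n)} (h : (r, s) ∈ rootPos t n) (μ : F) :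
    ∃ c d : F, rootMatrix r s μ = 1 + Matrix.single r s μ + Matrix.single s.rev r.rev c +
      Matrix.single r r.rev d ∧ (s = r.rev → c = 0 ∧ d = 0) := by
  have hrs := lt_of_mem_rootPos h
  have hC : s = r.rev → t = .C := fun hs => by
    rcases (mem_rootPos.1 h).2 with h | h
    · exact absurd hs h.ne
    · exact h.1
  unfold rootMatrix
  split_ifs with c1 c2 c3
  · refine ⟨-μ, -(μ ^ 2 / 2), ?_, fun h => by simpa [c1.1] using hC h⟩
    rw [← (val_eq_of_eq_B c1.1).1 c1.2, ← Matrix.single_neg, ← Matrix.single_neg]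
    abel
  · exact ⟨0, 0, by simp, fun _ => ⟨rfl, rfl⟩⟩
  · exact ⟨μ, 0, by simp, fun h => absurd ⟨c3.1, h⟩ c2⟩
  · exact ⟨-μ, 0, by simp [Matrix.single_neg, sub_eq_add_neg], fun h => absurd ⟨hC h, h⟩ c2⟩

/-- One step of elimination in row-by-row order. The factor changes only the columns s and r̄ of u,
by multiples of columns whose relevant entries are already zero, except at (r,s) itself, where the
diagonal entry 1 of u provides the cancellation. -/
theorem mul_rootMatrix_apply {r s : Fin (size t n)} (hrs : (r, s) ∈ rootPos t n)
    {u x : sylowU t n F} (hx : toMat x = rootMatrix r s (-toMat u r s))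
    (hu : ∀ p ∈ rootPos t n, p.1 < r ∨ (p.1 = r ∧ p.2 < s) → toMat u p.1 p.2 = 0)
    {k l : Fin (size t n)} (hkl : (k, l) ∈ rootPos t n) (h : k < r ∨ (k = r ∧ l ≤ s)) :
    toMat (u * x) k l = 0 := by
  obtain ⟨c, d, hX, h0⟩ := rootMatrix_eq hrs (-toMat u r s)
  have h1 := lt_of_mem_rootPos hrs
  have h2 := lt_rev_of_mem_rootPos hrs
  have hsr : s ≤ r.rev := by
    rcases (mem_rootPos.1 hrs).2 with h | h
    · exact h.le
    · exact h.2.le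
  have hmul : toMat (u * x) k l = toMat u k l + (if s = l then -(toMat u k r * toMat u r s) else 0)
      + (if r.rev = l then toMat u k s.rev * c + toMat u k r * d else 0) := by
    rw [toMat_mul, hx, hX, Matrix.mul_add, Matrix.mul_add, Matrix.mul_add, Matrix.mul_one]
    simp only [Matrix.add_apply, Matrix.mul_apply, Matrix.single_apply]
    simp only [mul_ite, mul_zero, ite_and, Finset.sum_ite_eq, Finset.mem_univ, if_true]
    split_ifs <;> simp [add_assoc]
  have hku : k < r → toMat u k r = 0 := fun hk =>
    hu (k, r) (mem_rootPos.2 ⟨hk, Or.inl (h2.trans (Fin.rev_lt_rev.2 hk))⟩) (Or.inl hk)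
  rw [hmul]
  rcases h with hk | ⟨rfl, hl⟩
  · rw [hku hk, hu (k, l) hkl (Or.inl hk)]
    by_cases hl : r.rev = l
    · rw [if_pos hl]
      by_cases hs : s = r.rev
      · simp [(h0 hs).1]
      · have hrs' : r < s.rev := by
          rw [← Fin.rev_rev r]; exact Fin.rev_lt_rev.2 (lt_of_le_of_ne hsr hs)
        rw [hu (k, s.rev) (mem_rootPos.2 ⟨hk.trans hrs', Or.inl
          ((Fin.rev_lt_rev.2 h1).trans (Fin.rev_lt_rev.2 hk))⟩) (Or.inl hk)]
        simp
    · simp [hl]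
  · rcases hl.lt_or_eq with hl | rfl
    · have h3 : k.rev ≠ l := (hl.trans_le hsr).ne'
      rw [if_neg hl.ne', if_neg h3, hu (k, l) hkl (Or.inr ⟨rfl, hl⟩)]
      simp
    · rw [if_pos rfl, toMat_diag]
      by_cases hs : k.rev = l
      · simp [h0 hs.symm]
      · simp [hs]

/-- Vanishing on ϱ is preserved by multiplication because ϱ is closed under moving left within a
row. Conversely, such a u is reduced to 1 by clearing the root positions one after another;
positions in ϱ are already zero, so only generators of U_{i,j} are used. -/
theorem mem_elementarySubgroup_iff (hF : (2 : F) ≠ 0) {i j : Fin (size t n)} {u : sylowU t n F} :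
    u ∈ elementarySubgroup F i j ↔ ∀ p ∈ removed i j, toMat u p.1 p.2 = 0 := by
  refine ⟨elementarySubgroup_removed, ?_⟩
  -- `finProdFinEquiv` numbers the positions row by row, and d is the number of positions at the end
  -- of this list that may still be nonzero.
  have key : ∀ d : ℕ, ∀ u : sylowU t n F, (∀ p ∈ removed i j, toMat u p.1 p.2 = 0) →
      (∀ p ∈ rootPos t n, (finProdFinEquiv p : ℕ) + d < size t n * size t n →
        toMat u p.1 p.2 = 0) → u ∈ elementarySubgroup F i j := by
    intro d
    induction d with
    | zero =>
      intro u _ hu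
      rw [eq_one_of_rootPos hF fun r s h => hu (r, s) h (finProdFinEquiv (r, s)).2]
      exact one_mem _
    | succ d ih =>
      intro u hu h0
      by_cases h : ∃ p ∈ rootPos t n, (finProdFinEquiv p : ℕ) + d + 1 = size t n * size t n ∧
          toMat u p.1 p.2 ≠ 0
      · obtain ⟨⟨r, s⟩, hp, hk, hne⟩ := h
        obtain ⟨x, hx⟩ := exists_toMat_eq_rootMatrix hF hp (-toMat u r s)
        have hxH : x ∈ elementarySubgroup F i j := by
          refine Subgroup.subset_closure ⟨(r, s), ?_, _, hx⟩
          exact Finset.mem_sdiff.2 ⟨hp, fun h => hne (hu _ h)⟩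
        have hlex : ∀ k l : Fin (size t n), (finProdFinEquiv (k, l) : ℕ) ≤ finProdFinEquiv (r, s) ↔
            k < r ∨ (k = r ∧ l ≤ s) := by
          intro k l
          rw [finProdFinEquiv_apply_val, finProdFinEquiv_apply_val]
          have hl := l.2
          have hs := s.2
          simp only [Fin.lt_def, Fin.le_def, Fin.ext_iff]
          constructor
          · intro h
            rcases lt_trichotomy (k : ℕ) r with h1 | h1 | h1
            · exact Or.inl h1
            · rw [h1] at h; exact Or.inr ⟨h1, by omega⟩
            · have := Nat.mul_le_mul_left (size t n) h1
              rw [Nat.mul_succ] at this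
              omega
          · rintro (h | ⟨h, h'⟩)
            · have := Nat.mul_le_mul_left (size t n) h
              rw [Nat.mul_succ] at this
              omega
            · rw [h]; omega
        refine (Subgroup.mul_mem_cancel_right _ hxH).1 (ih (u * x) ?_ ?_)
        · rintro ⟨a, b⟩ hab
          rw [mul_apply_removed hab hu]
          exact elementarySubgroup_removed hxH _ hab
        · rintro ⟨k, l⟩ hkl hd
          refine mul_rootMatrix_apply hp hx ?_ hkl ((hlex k l).1 (by omega))
          rintro ⟨k, l⟩ hkl hlt
          refine h0 _ hkl ?_
          have h1 : (finProdFinEquiv (k, l) : ℕ) ≤ finProdFinEquiv (r, s) :=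
            (hlex k l).2 (hlt.imp_right fun h => ⟨h.1, h.2.le⟩)
          have h2 : (finProdFinEquiv (k, l) : ℕ) ≠ finProdFinEquiv (r, s) := by
            intro h
            have := finProdFinEquiv.injective (Fin.ext h)
            simp only [Prod.mk.injEq] at this
            obtain ⟨rfl, rfl⟩ := this
            simp at hlt
          omega
      · push Not at h
        refine ih u hu fun p hp hd => ?_
        rcases lt_or_eq_of_le (Nat.succ_le_of_lt hd) with h1 | h1
        · exact h0 p hp (by omega)
        · exact h p hp (by omega)
  intro hu
  exact key (size t n * size t n) u hu fun p _ h => absurd h (by omega)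

end Generation

/-! ### Matrices with a single nonzero row, and their orbits. -/

section RowElements

variable {t : DynkinType} {n : ℕ} {F : Type*} [Field F]

/-- The elements of `V` whose only nonzero row is row `i`, where the rightmost nonzero entry is `α`
in column `j`. -/
def rowSet (i j : Fin (size t n)) (α : F) : Set (rootSpace t n F) :=
  {B | (∀ r s, r ≠ i → (B : Mat t n F) r s = 0) ∧ (B : Mat t n F) i j = α ∧
    ∀ k, j < k → (B : Mat t n F) i k = 0}

theorem apply_eq_zero_of_le (B : rootSpace t n F) {r s : Fin (size t n)} (h : s ≤ r) :
    (B : Mat t n F) r s = 0 :=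
  B.2 r s fun h' => (lt_of_mem_rootPos h').not_ge h

theorem rootElem_apply {i j : Fin (size t n)} (hij : (i, j) ∈ rootPos t n) (α : F)
    (r s : Fin (size t n)) :
    (rootElem hij α : Mat t n F) r s = if i = r ∧ j = s then α else 0 := Matrix.single_apply ..

theorem rootElem_mem_rowSet {i j : Fin (size t n)} (hij : (i, j) ∈ rootPos t n) (α : F) :
    rootElem hij α ∈ rowSet i j α := by
  refine ⟨fun r s h => ?_, ?_, fun k h => ?_⟩ <;> rw [rootElem_apply]
  · rw [if_neg fun h' => h h'.1.symm]
  · rw [if_pos ⟨rfl, rfl⟩]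
  · rw [if_neg fun h' => h.ne h'.2]

theorem minorElem_mem_rowSet (ht : t ≠ .C) {i j : Fin (size t n)}
    (hij : (i, j) ∈ rightTriangle t n) (hj : j.rev < j) (α β : F) :
    minorElem ht hij α β ∈ rowSet i j α := by
  have h1 := rootElem_mem_rowSet (minor_mem_rootPos ht hij) β
  have h2 := rootElem_mem_rowSet (Finset.mem_filter.1 hij).1 α
  refine ⟨fun r s h => ?_, ?_, fun k h => ?_⟩ <;>
    simp only [minorElem, Submodule.coe_add, Matrix.add_apply]
  · rw [h1.1 r s h, h2.1 r s h, add_zero]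
  · rw [h1.2.2 j hj, h2.2.1, zero_add]
  · rw [h1.2.2 k (hj.trans h), h2.2.2 k h, add_zero]

theorem rowSet_ext {i j : Fin (size t n)} {α : F} {B C : rootSpace t n F}
    (hB : B ∈ rowSet i j α) (hC : C ∈ rowSet i j α)
    (h : ∀ k, i < k → k < j → (B : Mat t n F) i k = (C : Mat t n F) i k) : B = C := by
  ext r s
  by_cases hr : r = i
  · subst hr
    rcases le_or_gt s r with h1 | h1
    · rw [apply_eq_zero_of_le B h1, apply_eq_zero_of_le C h1]
    · rcases lt_trichotomy s j with h2 | rfl | h2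
      · exact h s h1 h2
      · rw [hB.2.1, hC.2.1]
      · rw [hB.2.2 s h2, hC.2.2 s h2]
  · rw [hB.1 r s hr, hC.1 r s hr]

theorem dot_mem_rowSet {i j : Fin (size t n)} {α : F} {B : rootSpace t n F}
    (hB : B ∈ rowSet i j α) (u : sylowU t n F) : dot B u ∈ rowSet i j α := by
  refine ⟨fun r s h => ?_, ?_, dot_right_zero hB.2.2 u⟩
  · rw [dot_apply_of_right fun k _ => hB.1 r k h, hB.1 r s h]
  · rw [dot_apply_of_right hB.2.2, hB.2.1]

theorem verge_rootElem {i j : Fin (size t n)} (hij : (i, j) ∈ rootPos t n) {α : F} (hα : α ≠ 0) :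
    verge (rootElem hij α) = Matrix.single i j α := by
  ext r s
  simp only [verge, Matrix.of_apply]
  by_cases h : i = r ∧ j = s
  · obtain ⟨rfl, rfl⟩ := h
    have hA := rootElem_mem_rowSet hij α
    rw [if_pos ⟨by rw [hA.2.1]; exact hα, hA.2.2⟩, hA.2.1, Matrix.single_apply_same]
  · have h0 : (rootElem hij α : Mat t n F) r s = 0 := by rw [rootElem_apply, if_neg h]
    rw [h0, ite_self, Matrix.single_apply, if_neg h]

/-- Every nonzero row contributes its rightmost nonzero entry to the verge, so a verge with one
nonzero entry leaves only one nonzero row. -/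
theorem verge_eq_iff {i j : Fin (size t n)} (hij : (i, j) ∈ rootPos t n) {α : F} (hα : α ≠ 0)
    {B : rootSpace t n F} : verge B = verge (rootElem hij α) ↔ B ∈ rowSet i j α := by
  classical
  rw [verge_rootElem hij hα]
  constructor
  · intro h
    have hm : IsMain B i j := by
      by_contra hm
      have := congrFun (congrFun h i) j
      simp only [verge, Matrix.of_apply, if_neg hm, Matrix.single_apply_same] at this
      exact hα this.symm
    refine ⟨fun r s hr => ?_, ?_, hm.2⟩
    · by_contra hs
      let T := Finset.univ.filter fun k => (B : Mat t n F) r k ≠ 0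
      have hT : T.Nonempty := ⟨s, by simp [T, hs]⟩
      have hmax : IsMain B r (T.max' hT) := by
        refine ⟨(Finset.mem_filter.1 (T.max'_mem hT)).2, fun k hk => ?_⟩
        by_contra hk0
        exact hk.not_ge (T.le_max' k (by simp [T, hk0]))
      have := congrFun (congrFun h r) (T.max' hT)
      simp only [verge, Matrix.of_apply, if_pos hmax] at this
      rw [Matrix.single_apply, if_neg fun h => hr h.1.symm] at this
      exact hmax.1 this
    · have := congrFun (congrFun h i) j
      simpa only [verge, Matrix.of_apply, if_pos hm, Matrix.single_apply_same] using this
  · intro hB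
    ext r s
    simp only [verge, Matrix.of_apply]
    by_cases h : i = r ∧ j = s
    · obtain ⟨rfl, rfl⟩ := h
      rw [if_pos ⟨by rw [hB.2.1]; exact hα, hB.2.2⟩, hB.2.1, Matrix.single_apply_same]
    · rw [Matrix.single_apply, if_neg h, if_neg]
      intro hm
      by_cases hr : r = i
      · subst hr
        have hs : j ≠ s := fun hs => h ⟨rfl, hs⟩
        rcases lt_or_gt_of_ne hs with h1 | h1
        · exact hm.1 (hB.2.2 s h1)
        · exact hα (by rw [← hB.2.1]; exact hm.2 j h1)
      · exact hm.1 (hB.1 r s hr)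

/-- Acting by v⁻¹ removes the inverse from the formula: to the right of column i, row i read as a
column vector is multiplied by v. -/
theorem dot_row (B : rootSpace t n F) (v : sylowU t n F) {i r : Fin (size t n)} (hr : i < r) :
    (dot B v⁻¹ : Mat t n F) i r = ∑ l, (B : Mat t n F) i l * toMat v r l := by
  rw [dot_eq B _ hr, inv_inv, Matrix.mul_apply]
  rfl

/-- Only the column `j` of a group element matters if the other entries in its row `r` are
trivial. -/
theorem dot_row_of_trivial {i j : Fin (size t n)} {α : F} {B : rootSpace t n F}
    (hB : B ∈ rowSet i j α) {v : sylowU t n F} {r : Fin (size t n)} (hr : i < r)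
    (hv : ∀ l, l < j → toMat v r l = (1 : Mat t n F) r l) :
    (dot B v⁻¹ : Mat t n F) i r =
      (B : Mat t n F) i r + α * (toMat v r j - (1 : Mat t n F) r j) := by
  have h1 : (B : Mat t n F) i r = ∑ l, (B : Mat t n F) i l * (1 : Mat t n F) r l := by
    simp [Matrix.one_apply]
  rw [dot_row B v hr, ← sub_eq_iff_eq_add', h1, ← Finset.sum_sub_distrib,
    Finset.sum_eq_single j]
  · rw [hB.2.1, mul_sub]
  · intro l _ hl
    rcases lt_or_gt_of_ne hl with hl | hl
    · rw [hv l hl, sub_self]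
    · rw [hB.2.2 l hl, zero_mul, zero_mul, sub_self]
  · simp

theorem coeff_row (θ : AddChar F ℂ) {i j : Fin (size t n)} {α : F} {B : rootSpace t n F}
    (hB : B ∈ rowSet i j α) (u : sylowU t n F) :
    coeff θ B u = θ (-∑ l, (B : Mat t n F) i l * toMat u⁻¹ i l) := by
  rw [coeff, Matrix.trace]
  simp only [Matrix.diag_apply, Matrix.mul_apply, Matrix.transpose_apply]
  rw [Finset.sum_comm, Finset.sum_eq_single i]
  · intro r _ hr
    exact Finset.sum_eq_zero fun s _ => by rw [hB.1 r s hr, zero_mul]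
  · simp

theorem exists_map_mul_ne_one {θ : AddChar F ℂ} (hθ : θ ≠ 1) {c : F} (hc : c ≠ 0) :
    ∃ μ, θ (μ * c) ≠ 1 := by
  obtain ⟨d, hd⟩ := AddChar.ne_one_iff.1 hθ
  exact ⟨d / c, by rwa [div_mul_cancel₀ _ hc]⟩

/-- There are elements of `U` which act on the span of `rowSet i j α` by diagonal matrices and
separate the basis vectors. -/
theorem exists_coeff_ne (hF : (2 : F) ≠ 0) {θ : AddChar F ℂ} (hθ : θ ≠ 1) {i j : Fin (size t n)}
    (hj : j < i.rev) {α : F} {B C : rootSpace t n F} (hB : B ∈ rowSet i j α)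
    (hC : C ∈ rowSet i j α) (hBC : B ≠ C) :
    ∃ u : sylowU t n F, (∀ D ∈ rowSet i j α, dot D u = D) ∧ coeff θ B u ≠ coeff θ C u := by
  have hk : ∃ k, i < k ∧ k < j ∧ (B : Mat t n F) i k ≠ (C : Mat t n F) i k := by
    by_contra! h
    exact hBC (rowSet_ext hB hC h)
  obtain ⟨k, hik, hkj, hne⟩ := hk
  obtain ⟨μ, hμ⟩ := exists_map_mul_ne_one hθ (sub_ne_zero.2 hne)
  -- Apart from the entry μ at (i,k), the nontrivial entries of v lie in column ī, to the right of
  -- j, where all rows in question vanish. The entry at (i,k) could change only the diagonal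
  -- position of row i, which π discards, so it is seen by the coefficient alone.
  obtain ⟨v, hv, -, hv'⟩ := exists_toMat_apply_eq hF hik (Or.inl (hkj.trans hj).ne) μ
  have hv' := hv' ((hik.trans hkj).trans hj).ne
  have hcoeff : ∀ D ∈ rowSet i j α, coeff θ D v⁻¹ = θ (-((D : Mat t n F) i k * μ)) := by
    intro D hD
    rw [coeff_row θ hD, inv_inv, Finset.sum_eq_single k, hv]
    · intro l _ hl
      rcases lt_or_ge j l with h1 | h1
      · rw [hD.2.2 l h1, zero_mul]
      · rcases eq_or_ne l i with rfl | h2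
        · rw [apply_eq_zero_of_le D le_rfl, zero_mul]
        · rw [hv' i l (fun h => hl (Prod.ext_iff.1 h).2) (h1.trans_lt hj).ne,
            Matrix.one_apply_ne h2.symm, mul_zero]
    · simp
  refine ⟨v⁻¹, fun D hD => ?_, ?_⟩
  · refine rowSet_ext (dot_mem_rowSet hD _) hD fun r hir hrj => ?_
    have hr : ∀ l, l ≤ j → toMat v r l = (1 : Mat t n F) r l := fun l hl =>
      hv' r l (fun h => hir.ne' (Prod.ext_iff.1 h).1) (hl.trans_lt hj).ne
    rw [dot_row_of_trivial hD hir fun l hl => hr l hl.le, hr j le_rfl, sub_self, mul_zero, add_zero]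
  · rw [hcoeff B hB, hcoeff C hC]
    intro h
    apply hμ
    have h1 : μ * ((B : Mat t n F) i k - (C : Mat t n F) i k) =
        -((C : Mat t n F) i k * μ) - -((B : Mat t n F) i k * μ) := by ring
    rw [h1, AddChar.map_sub_eq_div, ← h, div_self]
    exact (AddChar.val_isUnit θ _).ne_zero

/-- Every element of `rowSet i j α` can be moved to one which vanishes in row `i` outside the
columns `j` and `j.rev`. -/
theorem exists_dot_apply_eq_zero (hF : (2 : F) ≠ 0) {i j : Fin (size t n)} {α : F} (hα : α ≠ 0)
    {B : rootSpace t n F} (hB : B ∈ rowSet i j α) :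
    ∃ u : sylowU t n F, ∀ k, k ≠ j → k ≠ j.rev → (dot B u : Mat t n F) i k = 0 := by
  suffices h : ∀ T : Finset (Fin (size t n)), (∀ k ∈ T, k ≠ j ∧ k ≠ j.rev) →
      ∃ u : sylowU t n F, ∀ k ∈ T, (dot B u : Mat t n F) i k = 0 by
    obtain ⟨u, hu⟩ := h (Finset.univ.filter fun k => k ≠ j ∧ k ≠ j.rev) (by simp)
    exact ⟨u, fun k h1 h2 => hu k (by simp [h1, h2])⟩
  intro T
  induction T using Finset.induction_on with
  | empty => exact fun _ => ⟨1, by simp⟩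
  | insert k T hkT ih =>
    intro hT
    obtain ⟨u, hu⟩ := ih fun l hl => hT l (Finset.mem_insert_of_mem hl)
    obtain ⟨hkj, hkr⟩ := hT k (Finset.mem_insert_self k T)
    have hB' := dot_mem_rowSet hB u
    by_cases hk : i < k ∧ k < j
    · obtain ⟨v, hv, hv1, hv2⟩ := exists_toMat_apply_eq hF hk.2
        (Or.inl fun h => hkr (by rw [h, Fin.rev_rev])) (-((dot B u : Mat t n F) i k / α))
      have key : ∀ r l, r ≠ j.rev → l ≤ j → (r, l) ≠ (k, j) →
          toMat v r l = (1 : Mat t n F) r l := by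
        intro r l hr hl hrl
        by_cases hjr : j = j.rev
        · have : j < k.rev := by rw [hjr]; exact Fin.rev_lt_rev.2 hk.2
          exact hv2 (hk.2.trans this).ne r l hrl (hl.trans_lt this).ne
        · exact hv1 hjr r l hrl hr
      refine ⟨u * v⁻¹, fun l hl => ?_⟩
      rw [dot_mul]
      rcases le_or_gt l i with hli | hli
      · exact apply_eq_zero_of_le _ hli
      obtain ⟨hlj, hlr⟩ := hT l hl
      rw [dot_row_of_trivial hB' hli fun m hm =>
        key l m hlr hm.le fun h => hm.ne (Prod.ext_iff.1 h).2, Matrix.one_apply_ne hlj, sub_zero]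
      rcases eq_or_ne l k with rfl | hlk
      · rw [hv]; field_simp; ring
      · rw [key l j hlr le_rfl fun h => hlk (Prod.ext_iff.1 h).1, Matrix.one_apply_ne hlj,
          hu l (Finset.mem_of_mem_insert_of_ne hl hlk), mul_zero, add_zero]
    · refine ⟨u, fun l hl => ?_⟩
      rcases Finset.mem_insert.1 hl with rfl | hl
      · rcases le_or_gt l i with h | h
        · exact apply_eq_zero_of_le _ h
        · exact hB'.2.2 l (lt_of_le_of_ne (not_lt.1 fun h' => hk ⟨h, h'⟩) (Ne.symm hkj))
      · exact hu l hl

theorem mem_orbit_of_dot_eq {A B : rootSpace t n F} {u : sylowU t n F} (h : dot B u = A) :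
    B ∈ orbit A := ⟨u⁻¹, by rw [← h, ← dot_mul, mul_inv_cancel, dot_one]⟩

theorem orbit_subset_rowSet {i j : Fin (size t n)} {α : F} {A : rootSpace t n F}
    (hA : A ∈ rowSet i j α) : orbit A ⊆ rowSet i j α := by
  rintro _ ⟨u, rfl⟩
  exact dot_mem_rowSet hA u

/-- After clearing, only column j̄ can be nonzero besides j, and only if i < j̄ < j. This is
impossible when j ≤ j̄; in type ℭ the position (j̄, j) is on the antidiagonal and its long root
element clears the column. -/
theorem orbit_rootElem (hF : (2 : F) ≠ 0) {i j : Fin (size t n)} (hij : (i, j) ∈ rootPos t n)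
    (h : t = .C ∨ j ≤ j.rev) {α : F} (hα : α ≠ 0) : orbit (rootElem hij α) = rowSet i j α := by
  have hA := rootElem_mem_rowSet hij α
  refine (orbit_subset_rowSet hA).antisymm fun B hB => ?_
  obtain ⟨u, hu⟩ := exists_dot_apply_eq_zero hF hα hB
  have hB' := dot_mem_rowSet hB u
  have hA0 : ∀ k, k < j → (rootElem hij α : Mat t n F) i k = 0 := fun k hk => by
    rw [rootElem_apply, if_neg fun h => hk.ne' h.2]
  by_cases hj : i < j.rev ∧ j.rev < j
  · have ht : t = .C := h.resolve_right hj.2.not_ge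
    obtain ⟨v, hv, hv1, hv2⟩ := exists_toMat_apply_eq hF hj.2 (Or.inr ht)
      (-((dot B u : Mat t n F) i j.rev / α))
    have hv1 := hv1 hj.2.ne'
    have hv2 := hv2 (by rw [Fin.rev_rev]; exact hj.2.ne)
    rw [Fin.rev_rev] at hv2
    refine mem_orbit_of_dot_eq (u := u * v⁻¹) ?_
    rw [dot_mul]
    refine rowSet_ext (dot_mem_rowSet hB' _) hA fun k hik hkj => ?_
    rw [dot_row_of_trivial hB' hik fun m hm =>
      hv2 k m (fun h => hm.ne (Prod.ext_iff.1 h).2) hm.ne, Matrix.one_apply_ne hkj.ne, sub_zero,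
      hA0 k hkj]
    rcases eq_or_ne k j.rev with rfl | hk
    · rw [hv]; field_simp; ring
    · rw [hv1 k j (fun h => hk (Prod.ext_iff.1 h).1) hk, Matrix.one_apply_ne hkj.ne, hu k hkj.ne hk,
        mul_zero, add_zero]
  · refine mem_orbit_of_dot_eq (u := u) (rowSet_ext hB' hA fun k hik hkj => ?_)
    rw [hA0 k hkj, hu k hkj.ne fun h => hj (h ▸ ⟨hik, hkj⟩)]

theorem minorElem_apply (ht : t ≠ .C) {i j : Fin (size t n)} (hij : (i, j) ∈ rightTriangle t n)
    (hj : j.rev < j) (α β : F) (k : Fin (size t n)) : (minorElem ht hij α β : Mat t n F) i k =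
      if k = j.rev then β else if k = j then α else 0 := by
  simp only [minorElem, Submodule.coe_add, Matrix.add_apply, rootElem_apply, true_and]
  rcases eq_or_ne k j.rev with rfl | h1
  · simp [hj.ne']
  · simp [h1, Ne.symm h1, eq_comm]

theorem exists_mem_orbit_minorElem (hF : (2 : F) ≠ 0) (ht : t ≠ .C) {i j : Fin (size t n)}
    (hij : (i, j) ∈ rightTriangle t n) (hj : j.rev < j) {α : F} (hα : α ≠ 0)
    {B : rootSpace t n F} (hB : B ∈ rowSet i j α) :
    ∃ β, B ∈ orbit (minorElem ht hij α β) := by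
  obtain ⟨u, hu⟩ := exists_dot_apply_eq_zero hF hα hB
  refine ⟨(dot B u : Mat t n F) i j.rev, mem_orbit_of_dot_eq (u := u) ?_⟩
  refine rowSet_ext (dot_mem_rowSet hB u) (minorElem_mem_rowSet ht hij hj _ _) fun k _ hkj => ?_
  rw [minorElem_apply ht hij hj]
  split_ifs with h1 h2
  · rw [h1]
  · exact absurd h2 hkj.ne
  · exact hu k h2 h1

/-- The value of the quadratic form on row `i` is invariant under the action of `U`. -/
theorem sum_dot_mul_dot_rev (ht : t ≠ .C) {i j : Fin (size t n)} (hj : j < i.rev) {α : F}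
    {B : rootSpace t n F} (hB : B ∈ rowSet i j α) (u : sylowU t n F) :
    ∑ k, (dot B u : Mat t n F) i k * (dot B u : Mat t n F) i k.rev =
      ∑ k, (B : Mat t n F) i k * (B : Mat t n F) i k.rev := by
  have hS : ∀ b : Fin (size t n) → F, b ⬝ᵥ (gram t n F *ᵥ b) = ∑ k, b k * b k.rev := by
    intro b
    simp only [dotProduct, Matrix.mulVec, gram, Matrix.of_apply, formSign_of_ne ht]
    simp
  have hu : u = (u⁻¹)⁻¹ := (inv_inv u).symm
  set v := u⁻¹
  set b : Fin (size t n) → F := fun k => (B : Mat t n F) i k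
  have h1 : (toMat v *ᵥ b) ⬝ᵥ (gram t n F *ᵥ (toMat v *ᵥ b)) = b ⬝ᵥ (gram t n F *ᵥ b) := by
    rw [Matrix.dotProduct_mulVec, Matrix.dotProduct_mulVec, Matrix.vecMul_mulVec,
      Matrix.vecMul_vecMul, transpose_mul_gram_mul, ← Matrix.dotProduct_mulVec]
  rw [hS, hS] at h1
  rw [← h1]
  have hlow : ∀ k, j < k → (toMat v *ᵥ b) k = 0 := by
    intro k hk
    rw [Matrix.mulVec, dotProduct]
    refine Finset.sum_eq_zero fun l _ => ?_
    rcases lt_or_ge l k with hl | hl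
    · rw [toMat_lower v hl, zero_mul]
    · rw [show b l = 0 from hB.2.2 l (hk.trans_le hl), mul_zero]
  have heq : ∀ k, i < k → (dot B u : Mat t n F) i k = (toMat v *ᵥ b) k := by
    intro k hk
    rw [hu, dot_row B v hk]
    exact Finset.sum_congr rfl fun l _ => mul_comm _ _
  -- The truncation by π to columns right of i does not affect the form: if one of k, k̄ is at most
  -- i, the other is at least ī > j, where both vectors vanish.
  refine Finset.sum_congr rfl fun k _ => ?_
  by_cases hk : i < k
  · by_cases hk' : i < k.rev
    · rw [heq k hk, heq _ hk']
    · have : j < k := hj.trans_le (by rw [← Fin.rev_rev k]; exact Fin.rev_le_rev.2 (not_lt.1 hk'))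
      rw [hlow k this, (dot_mem_rowSet hB u).2.2 k this, zero_mul, zero_mul]
  · have : j < k.rev := hj.trans_le (Fin.rev_le_rev.2 (not_lt.1 hk))
    rw [hlow _ this, (dot_mem_rowSet hB u).2.2 _ this, mul_zero, mul_zero]

/-- The quadratic form takes the value 2αβ on row i of A_β, and 2α is invertible. -/
theorem disjoint_orbit_minorElem (hF : (2 : F) ≠ 0) (ht : t ≠ .C) {i j : Fin (size t n)}
    (hij : (i, j) ∈ rightTriangle t n) (hj : j.rev < j) (hji : j < i.rev) {α : F} (hα : α ≠ 0)
    {β γ : F} (hβγ : β ≠ γ) :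
    Disjoint (orbit (minorElem ht hij α β)) (orbit (minorElem ht hij α γ)) := by
  rw [Set.disjoint_left]
  rintro _ ⟨u, rfl⟩ ⟨v, hv⟩
  have hQ : ∀ β, ∑ k, (minorElem ht hij α β : Mat t n F) i k *
      (minorElem ht hij α β : Mat t n F) i k.rev = 2 * α * β := by
    intro β
    rw [Finset.sum_eq_add j j.rev hj.ne']
    · simp only [minorElem_apply ht hij hj, Fin.rev_rev, if_true, if_neg hj.ne', if_neg hj.ne]
      ring
    · rintro k _ ⟨h1, h2⟩
      rw [minorElem_apply ht hij hj, if_neg h2, if_neg h1, zero_mul]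
    · simp
    · simp
  have h1 := sum_dot_mul_dot_rev ht hji (minorElem_mem_rowSet ht hij hj α β) u
  have h2 := sum_dot_mul_dot_rev ht hji (minorElem_mem_rowSet ht hij hj α γ) v
  rw [hv, h1, hQ, hQ] at h2
  exact hβγ (mul_left_cancel₀ (mul_ne_zero hF hα) h2)

end RowElements

/-! ### Submodules of the monomial module. -/

section MonomialModules

variable {t : DynkinType} {n : ℕ} {F : Type*} [Field F]

theorem dot_injective (u : sylowU t n F) :
    Function.Injective fun A : rootSpace t n F => dot A u := fun A B h => by
  have := congrArg (fun C => dot C u⁻¹) h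
  simpa only [← dot_mul, mul_inv_cancel, dot_one] using this

theorem dot_inv_dot (A : rootSpace t n F) (u : sylowU t n F) : dot (dot A u⁻¹) u = A := by
  rw [← dot_mul, inv_mul_cancel, dot_one]

theorem coeff_ne_zero (θ : AddChar F ℂ) (A : rootSpace t n F) (u : sylowU t n F) :
    coeff θ A u ≠ 0 := (AddChar.val_isUnit θ _).ne_zero

theorem monomialRep_single (θ : AddChar F ℂ) (u : sylowU t n F) (A : rootSpace t n F) (c : ℂ) :
    monomialRep θ (MulOpposite.op u) (Finsupp.single A c) =
      Finsupp.single (dot A u) (c * coeff θ A u) := by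
  change Finsupp.linearCombination ℂ _ _ = _
  rw [Finsupp.linearCombination_single, Finsupp.smul_single, smul_eq_mul]
  rfl

theorem monomialRep_apply_dot (θ : AddChar F ℂ) (u : sylowU t n F) (x : rootSpace t n F →₀ ℂ)
    (A : rootSpace t n F) :
    monomialRep θ (MulOpposite.op u) x (dot A u) = x A * coeff θ A u := by
  classical
  induction x using Finsupp.induction_linear with
  | zero => simp
  | add x y hx hy => rw [map_add, Finsupp.add_apply, hx, hy, Finsupp.add_apply, add_mul]
  | single B c =>
    rw [monomialRep_single, Finsupp.single_apply, Finsupp.single_apply]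
    by_cases h : B = A
    · rw [if_pos (congrArg (fun C => dot C u) h), if_pos h, h]
    · rw [if_neg fun h' => h (dot_injective u h'), if_neg h, zero_mul]

/-- The invariant submodules of the span of `rowSet i j α` are spanned by basis vectors. -/
theorem single_mem_of_apply_ne_zero (hF : (2 : F) ≠ 0) {θ : AddChar F ℂ} (hθ : θ ≠ 1)
    {i j : Fin (size t n)} (hj : j < i.rev) {α : F} {P : Submodule ℂ (rootSpace t n F →₀ ℂ)}
    (hP : ∀ u, ∀ x ∈ P, monomialRep θ u x ∈ P) (hle : P ≤ Finsupp.supported ℂ ℂ (rowSet i j α))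
    {x : rootSpace t n F →₀ ℂ} (hx : x ∈ P) {B : rootSpace t n F} (hB : x B ≠ 0) :
    Finsupp.single B 1 ∈ P := by
  classical
  induction hm : x.support.card using Nat.strong_induction_on generalizing x with
  | _ m ih =>
    by_cases h : ∃ C, x C ≠ 0 ∧ B ≠ C
    · obtain ⟨C, hC, hBC⟩ := h
      have hrow : ∀ D, x D ≠ 0 → D ∈ rowSet i j α := fun D hD =>
        hle hx (Finsupp.mem_support_iff.2 hD)
      obtain ⟨u, hu, hne⟩ := exists_coeff_ne hF hθ hj (hrow B hB) (hrow C hC) hBC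
      have hval : ∀ D, monomialRep θ (MulOpposite.op u) x D = x D * coeff θ D u := by
        intro D
        by_cases hD : D ∈ rowSet i j α
        · conv_lhs => rw [← hu D hD]
          rw [monomialRep_apply_dot]
        · have h1 : x D = 0 := by_contra fun h => hD (hrow D h)
          have h2 : monomialRep θ (MulOpposite.op u) x D = 0 :=
            by_contra fun h => hD (hle (hP _ x hx) (Finsupp.mem_support_iff.2 h))
          rw [h1, h2, zero_mul]
      -- The element u acts diagonally, with different scalars at B and C. Subtracting the scalar at
      -- C removes C from the support and keeps B.
      have hy : monomialRep θ (MulOpposite.op u) x - coeff θ C u • x ∈ P :=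
        sub_mem (hP _ x hx) (P.smul_mem _ hx)
      have hyD : ∀ D, (monomialRep θ (MulOpposite.op u) x - coeff θ C u • x) D =
          x D * (coeff θ D u - coeff θ C u) := by
        intro D
        rw [Finsupp.sub_apply, hval, Finsupp.smul_apply, smul_eq_mul]
        ring
      refine ih _ ?_ hy ?_ rfl
      · rw [← hm]
        refine Finset.card_lt_card ⟨fun D hD => ?_, fun h => ?_⟩
        · rw [Finsupp.mem_support_iff, hyD] at hD
          exact Finsupp.mem_support_iff.2 (left_ne_zero_of_mul hD)
        · have := h (Finsupp.mem_support_iff.2 hC)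
          rw [Finsupp.mem_support_iff, hyD, sub_self, mul_zero] at this
          exact this rfl
      · rw [hyD]
        exact mul_ne_zero hB (sub_ne_zero.2 hne)
    · push Not at h
      have hxB : x = Finsupp.single B (x B) := by
        ext D
        rw [Finsupp.single_apply]
        split_ifs with hD
        · rw [hD]
        · exact by_contra fun h' => hD (h D h')
      have : Finsupp.single B (1 : ℂ) = (x B)⁻¹ • x := by
        conv_rhs => rw [hxB]
        rw [Finsupp.smul_single, Finsupp.single_eq_same, smul_eq_mul, inv_mul_cancel₀ hB]
      rw [this]
      exact P.smul_mem _ hx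

theorem single_mem_of_mem_orbit {θ : AddChar F ℂ} {P : Submodule ℂ (rootSpace t n F →₀ ℂ)}
    (hP : ∀ u, ∀ x ∈ P, monomialRep θ u x ∈ P) {A B C : rootSpace t n F}
    (hA : Finsupp.single A 1 ∈ P) (hAC : A ∈ orbit C) (hB : B ∈ orbit C) :
    Finsupp.single B 1 ∈ P := by
  obtain ⟨u, rfl⟩ := hAC
  obtain ⟨v, rfl⟩ := hB
  have h := hP (MulOpposite.op (u⁻¹ * v)) _ hA
  rw [monomialRep_single, ← dot_mul, mul_inv_cancel_left, one_mul] at h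
  have h' := P.smul_mem (coeff θ (dot C u) (u⁻¹ * v))⁻¹ h
  rwa [Finsupp.smul_single, smul_eq_mul, inv_mul_cancel₀ (coeff_ne_zero _ _ _)] at h'

theorem toRepresentation_apply_coe {θ : AddChar F ℂ}
    (S : Subrepresentation (monomialRep (t := t) (n := n) θ)) (u : (sylowU t n F)ᵐᵒᵖ)
    (x : S.toSubmodule) :
    (S.toRepresentation u x : rootSpace t n F →₀ ℂ) = monomialRep θ u x := rfl

/-- A nonzero invariant subspace contains a basis vector, and U permutes the basis vectors of an
orbit transitively up to nonzero scalars. -/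
theorem isIrreducible_orbitModule (hF : (2 : F) ≠ 0) {θ : AddChar F ℂ} (hθ : θ ≠ 1)
    {i j : Fin (size t n)} (hj : j < i.rev) {α : F} {A : rootSpace t n F}
    (hA : A ∈ rowSet i j α) :
    Representation.IsIrreducible (k := ℂ) (G := (sylowU t n F)ᵐᵒᵖ)
      (V := (orbitModule θ A).toSubmodule) (orbitModule θ A).toRepresentation := by
  have hAA : A ∈ orbit A := ⟨1, dot_one A⟩
  have hmem : Finsupp.single A (1 : ℂ) ∈ (orbitModule θ A).toSubmodule :=
    Finsupp.single_mem_supported ℂ _ hAA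
  have : Nontrivial (orbitModule θ A).toSubmodule :=
    ⟨⟨⟨_, hmem⟩, 0, fun h => by simpa using congrArg Subtype.val h⟩⟩
  refine Representation.isIrreducible_of_forall_submodule fun P hP => ?_
  refine or_iff_not_imp_left.2 fun hne => ?_
  obtain ⟨x, hx, hx0⟩ := (Submodule.ne_bot_iff P).1 hne
  set Q := P.map (orbitModule θ A).toSubmodule.subtype
  have hQinv : ∀ u, ∀ y ∈ Q, monomialRep θ u y ∈ Q := by
    rintro u _ ⟨y, hy, rfl⟩
    exact ⟨_, hP u y hy, rfl⟩
  have hQle : Q ≤ (orbitModule θ A).toSubmodule := Submodule.map_subtype_le _ _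
  have hle : Q ≤ Finsupp.supported ℂ ℂ (rowSet i j α) :=
    hQle.trans (Finsupp.supported_mono (orbit_subset_rowSet hA))
  obtain ⟨B, hB⟩ := Finsupp.ne_iff.1 fun h : (x : rootSpace t n F →₀ ℂ) = 0 => hx0 (Subtype.ext h)
  have hBQ := single_mem_of_apply_ne_zero hF hθ hj hQinv hle
    (Submodule.mem_map_of_mem (f := (orbitModule θ A).toSubmodule.subtype) hx) hB
  have hBA : B ∈ orbit A := x.2 (Finsupp.mem_support_iff.2 hB)
  have htop : (orbitModule θ A).toSubmodule ≤ Q := by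
    change Finsupp.supported ℂ ℂ (orbit A) ≤ Q
    rw [Finsupp.supported_eq_span_single, Submodule.span_le]
    rintro _ ⟨C, hC, rfl⟩
    exact single_mem_of_mem_orbit hQinv hBQ hBA hC
  refine eq_top_iff.2 fun y _ => ?_
  obtain ⟨z, hz, hzy⟩ := htop y.2
  rwa [← Subtype.ext hzy]

/-- The image of [A] involves some [C] with C in the other orbit. A diagonally acting u that
separates A from C would have to multiply that coefficient by two different scalars. -/
theorem isEmpty_equiv_orbitModule (hF : (2 : F) ≠ 0) {θ : AddChar F ℂ} (hθ : θ ≠ 1)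
    {i j : Fin (size t n)} (hj : j < i.rev) {α : F} {A B : rootSpace t n F}
    (hA : A ∈ rowSet i j α) (hB : B ∈ rowSet i j α) (hAB : Disjoint (orbit A) (orbit B)) :
    IsEmpty ((orbitModule θ A).toRepresentation.Equiv (orbitModule θ B).toRepresentation) := by
  refine ⟨fun e => ?_⟩
  have hAA : A ∈ orbit A := ⟨1, dot_one A⟩
  let a : (orbitModule θ A).toSubmodule :=
    ⟨Finsupp.single A 1, Finsupp.single_mem_supported ℂ _ hAA⟩
  have ha : a ≠ 0 := fun h => by simpa [a] using congrArg Subtype.val h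
  have hea : e.toLinearEquiv a ≠ 0 := fun h => ha (e.toLinearEquiv.map_eq_zero_iff.1 h)
  obtain ⟨C, hC⟩ := Finsupp.ne_iff.1 fun h : (e.toLinearEquiv a : rootSpace t n F →₀ ℂ) = 0 =>
    hea (Subtype.ext h)
  have hCB : C ∈ orbit B := (e.toLinearEquiv a).2 (Finsupp.mem_support_iff.2 hC)
  have hCrow := orbit_subset_rowSet hB hCB
  have hAC : A ≠ C := fun h => Set.disjoint_left.1 hAB hAA (h ▸ hCB)
  obtain ⟨u, hu, hne⟩ := exists_coeff_ne hF hθ hj hA hCrow hAC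
  have h1 : (orbitModule θ A).toRepresentation (MulOpposite.op u) a = coeff θ A u • a := by
    apply Subtype.ext
    rw [toRepresentation_apply_coe, monomialRep_single, hu A hA, Submodule.coe_smul,
      Finsupp.smul_single, smul_eq_mul, one_mul, mul_one]
  have h2 : e.toLinearEquiv ((orbitModule θ A).toRepresentation (MulOpposite.op u) a) =
      (orbitModule θ B).toRepresentation (MulOpposite.op u) (e.toLinearEquiv a) :=
    Representation.IntertwiningMap.isIntertwining _ _ e.toIntertwiningMap (MulOpposite.op u) a
  rw [h1, map_smul] at h2
  have h3 := DFunLike.congr_fun (congrArg Subtype.val h2) C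
  rw [toRepresentation_apply_coe, Submodule.coe_smul, Finsupp.smul_apply, smul_eq_mul] at h3
  conv_rhs at h3 => rw [← hu C hCrow]
  rw [monomialRep_apply_dot, mul_comm] at h3
  exact hne (mul_left_cancel₀ hC h3)

theorem iSupIndep_supported {ι κ : Type*} {s : ι → Set κ}
    (hs : Pairwise (Function.onFun Disjoint s)) :
    iSupIndep fun k => Finsupp.supported ℂ ℂ (s k) := by
  intro k
  refine (Finsupp.disjoint_supported_supported (M := ℂ) (R := ℂ) (s := s k)
    (t := ⋃ l, ⋃ _ : l ≠ k, s l) ?_).mono_right ?_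
  · rw [Set.disjoint_iUnion₂_right]
    exact fun l hl => hs hl.symm
  · exact iSup₂_le fun l hl =>
      Finsupp.supported_mono (Set.subset_iUnion₂ (s := fun l (_ : l ≠ k) => s l) l hl)

end MonomialModules

/-! ### Eigenvectors of U_{i,j} in orbit modules. -/

section Eigenvectors

variable {t : DynkinType} {n : ℕ} {F : Type*} [Field F]

/-- The elements of `rowSet i j α` which vanish in the columns `n+1, …, j-1` of row `i`. -/
def leftRowSet (i j : Fin (size t n)) (α : F) : Set (rootSpace t n F) :=
  {B | B ∈ rowSet i j α ∧ ∀ k : Fin (size t n), n ≤ (k : ℕ) → k < j → (B : Mat t n F) i k = 0}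

theorem size_nTilde (t : DynkinType) (n : ℕ) : (size t n = 2 * n + 1 ∧ nTilde t n = n + 1) ∨
    (size t n = 2 * n ∧ nTilde t n = n) := by
  unfold size nTilde
  split_ifs <;> simp

theorem mem_removed {i j : Fin (size t n)} {a b : Fin (size t n)} :
    (a, b) ∈ removed i j ↔ (a, b) ∈ rootPos t n ∧
      (((j : ℕ) < nTilde t n ∧ a = i ∧ b < j) ∨ (nTilde t n ≤ (j : ℕ) ∧
        ((a = i ∧ (b : ℕ) < n) ∨ (a = j.rev ∧ (b : ℕ) < nTilde t n)))) := by
  unfold removed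
  split_ifs with h
  · simp [h]
  · simp [h, not_lt.1 h]

theorem mem_removed_of_lt {i j k : Fin (size t n)} (hij : (i, j) ∈ rootPos t n) (hik : i < k)
    (hkj : k < j) (hk : (k : ℕ) < n) : (i, k) ∈ removed i j := by
  have hkr : k < i.rev := by
    rcases (mem_rootPos.1 hij).2 with h | h
    · exact hkj.trans h
    · exact hkj.trans_eq h.2
  refine mem_removed.2 ⟨mem_rootPos.2 ⟨hik, Or.inl hkr⟩, ?_⟩
  rcases lt_or_ge (j : ℕ) (nTilde t n) with h | h
  · exact Or.inl ⟨h, rfl, hkj⟩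
  · exact Or.inr ⟨h, Or.inl ⟨rfl, hk⟩⟩

/-- For columns k right of n it is the mirror image of (k,j) that is removed. Since the form relates
u to u⁻¹ by reflection, elements of U_{i,j} vanish at (k,j), and the pivot in column j never spreads
to column k. -/
theorem rev_mem_removed {i j k : Fin (size t n)} (hkj : k < j) (hk : n ≤ (k : ℕ)) :
    (j.rev, k.rev) ∈ removed i j := by
  have hs := size_nTilde t n
  have hj := j.2
  rw [Fin.lt_def] at hkj
  rw [mem_removed, mem_rootPos]
  simp only [Fin.lt_def, Fin.val_rev, Fin.rev_rev, true_and]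
  exact ⟨⟨by omega, Or.inl (by omega)⟩, Or.inr ⟨by omega, Or.inr (by omega)⟩⟩

theorem dot_mem_leftRowSet {i j : Fin (size t n)} {α : F} {B : rootSpace t n F}
    (hB : B ∈ leftRowSet i j α) {h : sylowU t n F} (hh : h ∈ elementarySubgroup F i j) :
    dot B h ∈ leftRowSet i j α := by
  refine ⟨dot_mem_rowSet hB.1 h, fun k hk hkj => ?_⟩
  rcases le_or_gt k i with hki | hki
  · exact apply_eq_zero_of_le _ hki
  rw [← inv_inv h, dot_row B h⁻¹ hki]
  refine Finset.sum_eq_zero fun l _ => ?_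
  rcases lt_trichotomy l j with hl | rfl | hl
  · rcases lt_or_ge l k with h1 | h1
    · rw [toMat_lower _ h1, mul_zero]
    · rw [hB.2 l (hk.trans h1) hl, zero_mul]
  · have h1 := elementarySubgroup_removed hh _ (rev_mem_removed (i := i) hkj hk)
    rw [toMat_eq_zero_iff, Fin.rev_rev, Fin.rev_rev] at h1
    rw [h1, mul_zero]
  · rw [hB.1.2.2 l hl, zero_mul]

/-- In the sum over row i, the columns between i and j up to n drop out because (i,l) is removed,
and the later ones before j because B vanishes there. Column j remains, where passing to the inverse
is a change of sign. -/
theorem coeff_leftRowSet (θ : AddChar F ℂ) {i j : Fin (size t n)} (hij : (i, j) ∈ rootPos t n)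
    {α : F} {B : rootSpace t n F} (hB : B ∈ leftRowSet i j α)
    (h : elementarySubgroup F i j) :
    coeff θ B (h : sylowU t n F) = linearCharacter θ hij α h := by
  have h1 := entry_add hij h.2 (inv_mem h.2)
  rw [mul_inv_cancel, toMat_one, Matrix.one_apply_ne (lt_of_mem_rootPos hij).ne] at h1
  rw [coeff_row θ hB.1, Finset.sum_eq_single j]
  · change _ = θ (α * toMat (h : sylowU t n F) i j)
    rw [hB.1.2.1]
    congr 1
    linear_combination α * h1
  · intro l _ hl
    rcases lt_or_gt_of_ne hl with hl | hl
    · rcases le_or_gt l i with hli | hli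
      · rw [apply_eq_zero_of_le B hli, zero_mul]
      · rcases lt_or_ge (l : ℕ) n with hn | hn
        · rw [elementarySubgroup_removed (inv_mem h.2) _ (mem_removed_of_lt hij hli hl hn),
            mul_zero]
        · rw [hB.2 l hn hl, zero_mul]
    · rw [hB.1.2.2 l hl, zero_mul]
  · simp

variable [Finite F]

instance : Finite (rootSpace t n F) := Subtype.finite (α := Mat t n F)

/-- The sum of the basis vectors in a set. -/
noncomputable def basisSum (T : Set (rootSpace t n F)) : rootSpace t n F →₀ ℂ :=
  Finsupp.equivFunOnFinite.symm (T.indicator 1)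

open scoped Classical in
theorem basisSum_apply (T : Set (rootSpace t n F)) (B : rootSpace t n F) :
    basisSum T B = if B ∈ T then 1 else 0 := by
  simp [basisSum, Set.indicator_apply]

/-- The subgroup permutes T, and all monomial coefficients on T equal the value of the linear
character. -/
theorem monomialRep_basisSum {θ : AddChar F ℂ} {i j : Fin (size t n)}
    (hij : (i, j) ∈ rootPos t n) {α : F} {T : Set (rootSpace t n F)}
    (hT : T ⊆ leftRowSet i j α)
    (hdot : ∀ h ∈ elementarySubgroup F i j, ∀ B ∈ T, dot B h ∈ T) (h : elementarySubgroup F i j) :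
    monomialRep θ (MulOpposite.op (h : sylowU t n F)) (basisSum T) =
      linearCharacter θ hij α h • basisSum T := by
  classical
  ext C
  rw [← dot_inv_dot C h, monomialRep_apply_dot]
  set B := dot C (h : sylowU t n F)⁻¹
  rw [Finsupp.smul_apply, smul_eq_mul, basisSum_apply, basisSum_apply]
  by_cases hB : B ∈ T
  · rw [if_pos hB, if_pos (hdot _ h.2 B hB), coeff_leftRowSet θ hij (hT hB), one_mul, mul_one]
  · rw [if_neg hB, if_neg, zero_mul, mul_zero]
    intro h'
    have := hdot _ (inv_mem h.2) _ h'
    rw [← dot_mul, mul_inv_cancel, dot_one] at this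
    exact hB this

/-- Every orbit module which contains an element of `leftRowSet i j α` contains a vector on which
`U_{i,j}` acts through its linear character. -/
theorem exists_eigenvector_orbitModule (θ : AddChar F ℂ) {i j : Fin (size t n)}
    (hij : (i, j) ∈ rootPos t n) {α : F} {A : rootSpace t n F} (hA : A ∈ leftRowSet i j α) :
    ∃ x ∈ Representation.eigenvectors (W := (orbitModule θ A).toSubmodule)
      (orbitModule θ A).toRepresentation (elementarySubgroup F i j) (linearCharacter θ hij α),
      x ≠ 0 := by
  classical
  have hmem : basisSum (orbit A ∩ leftRowSet i j α) ∈ (orbitModule θ A).toSubmodule := by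
    change _ ∈ Finsupp.supported ℂ ℂ _
    rw [Finsupp.mem_supported']
    intro B hB
    rw [basisSum_apply, if_neg fun h => hB h.1]
  refine ⟨⟨_, hmem⟩, fun h => Subtype.ext ?_, fun h => ?_⟩
  · refine monomialRep_basisSum hij Set.inter_subset_right ?_ h
    rintro h hh _ ⟨⟨u, rfl⟩, hB⟩
    exact ⟨⟨u * h, dot_mul A u h⟩, dot_mem_leftRowSet hB hh⟩
  · have := DFunLike.congr_fun (congrArg Subtype.val h) A
    change basisSum _ A = 0 at this
    rw [basisSum_apply, if_pos ⟨⟨1, dot_one A⟩, hA⟩] at this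
    exact one_ne_zero this

end Eigenvectors

/-! ### Bounding the index of U_{i,j}. -/

section Index

variable {t : DynkinType} {n : ℕ} {F : Type*} [Field F]

/-- Entries in ϱ determine the coset: compare u = (u v⁻¹) v at (a,b) by induction on the column; the
intermediate terms involve positions of ϱ further left in row a. -/
theorem mul_inv_apply_removed {i j : Fin (size t n)} {u v : sylowU t n F}
    (h : ∀ p ∈ removed i j, toMat u p.1 p.2 = toMat v p.1 p.2) :
    ∀ p ∈ removed i j, toMat (u * v⁻¹) p.1 p.2 = 0 := by
  have key : ∀ m : ℕ, ∀ a b : Fin (size t n), (b : ℕ) = m → (a, b) ∈ removed i j →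
      toMat (u * v⁻¹) a b = 0 := by
    intro m
    induction m using Nat.strong_induction_on with
    | _ m ih =>
      rintro a b rfl hab
      have hlt : a < b := lt_of_mem_rootPos (mem_removed.1 hab).1
      have h1 : toMat u a b = ∑ c, toMat (u * v⁻¹) a c * toMat v c b := by
        rw [← Matrix.mul_apply, ← toMat_mul, inv_mul_cancel_right]
      rw [Finset.sum_eq_add a b hlt.ne, toMat_diag, toMat_diag, one_mul, mul_one, h _ hab] at h1
      · simpa using h1
      · rintro c _ ⟨hca, hcb⟩
        rcases lt_or_gt_of_ne hca with hc | hc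
        · rw [toMat_lower _ hc, zero_mul]
        · rcases lt_or_gt_of_ne hcb with hc' | hc'
          · rw [ih c hc' a c rfl (removed_row hab hc hc'.le), zero_mul]
          · rw [toMat_lower _ hc', mul_zero]
      · simp
      · simp
  exact fun p hp => key _ p.1 p.2 rfl hp

/-- Only an upper bound for the index is needed, since the modules constructed later bound dim M
from below. The set ι may enumerate ϱ with redundancy. -/
theorem card_sylowU_le [Finite F] (hF : (2 : F) ≠ 0) {i j : Fin (size t n)} {ι : Type*} [Finite ι]
    (e : ι → Pos t n) (he : ∀ p ∈ removed i j, ∃ k, e k = p) :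
    Nat.card (sylowU t n F) ≤ Nat.card (elementarySubgroup F i j) * Nat.card (ι → F) := by
  let Φ : sylowU t n F → ι → F := fun u k => toMat u (e k).1 (e k).2
  -- A representative with the given entries; the arbitrary values of `Function.invFun` outside the
  -- range of Φ play no role.
  let s : (ι → F) → sylowU t n F := Function.invFun Φ
  have hs : ∀ u, Φ (s (Φ u)) = Φ u := fun u => Function.invFun_eq ⟨u, rfl⟩
  have hmem : ∀ u, u * (s (Φ u))⁻¹ ∈ elementarySubgroup F i j := by
    intro u
    rw [mem_elementarySubgroup_iff hF]
    refine mul_inv_apply_removed fun p hp => ?_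
    obtain ⟨k, rfl⟩ := he p hp
    exact (congrFun (hs u) k).symm
  rw [← Nat.card_prod]
  refine Nat.card_le_card_of_injective
    (fun u => ((⟨_, hmem u⟩, Φ u) : elementarySubgroup F i j × (ι → F))) fun u v h => ?_
  simp only [Prod.mk.injEq, Subtype.mk.injEq] at h
  rw [h.2] at h
  exact mul_right_cancel h.1

theorem finrank_le_of_character [Finite F] (hF : (2 : F) ≠ 0) {θ : AddChar F ℂ}
    {i j : Fin (size t n)} (hij : (i, j) ∈ rootPos t n) {α : F}
    {M : Type*} [AddCommGroup M] [Module ℂ M] [FiniteDimensional ℂ M]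
    {ρ : Representation ℂ (sylowU t n F)ᵐᵒᵖ M}
    (hρ : ∀ u : sylowU t n F, ρ.character (MulOpposite.op u) = elementaryCharacter θ hij α u)
    {ι : Type*} [Finite ι] (e : ι → Pos t n) (he : ∀ p ∈ removed i j, ∃ k, e k = p) :
    Module.finrank ℂ M ≤ Nat.card (ι → F) := by
  have h1 := Representation.card_mul_finrank_eq_card hρ
  have h2 := card_sylowU_le hF e he
  rw [← h1] at h2
  exact Nat.le_of_mul_le_mul_left h2 Nat.card_pos

end Index

/-! ### The positions off the antidiagonal: M is the verge module. -/

section Main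

variable {t : DynkinType} {n : ℕ} {F : Type*} [Field F]

theorem exists_mem_rowSet {i j : Fin (size t n)} (hij : (i, j) ∈ rootPos t n) (α : F)
    (f : Fin (size t n) → F) :
    ∃ B ∈ rowSet i j α, ∀ k, i < k → k < j → (B : Mat t n F) i k = f k := by
  have hle : ∀ k, k < j → k < i.rev := fun k hk => by
    rcases (mem_rootPos.1 hij).2 with h | h
    · exact hk.trans h
    · exact hk.trans_eq h.2
  let X : Mat t n F := Matrix.of fun r s =>
    if r = i then (if s < j then f s else if s = j then α else 0) else 0
  have hX : ∀ r s, (r, s) ∈ rootPos t n → (proj X : Mat t n F) r s = X r s := fun r s h => by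
    simp [proj, h]
  have hX0 : ∀ r s, X r s = 0 → (proj X : Mat t n F) r s = 0 := fun r s h => by
    simp [proj, h]
  refine ⟨proj X, ⟨fun r s hr => hX0 r s (by simp [X, hr]), ?_, fun k hk => hX0 i k ?_⟩,
    fun k hik hkj => ?_⟩
  · rw [hX i j hij]; simp [X]
  · simp [X, hk.not_gt, hk.ne']
  · rw [hX i k (mem_rootPos.2 ⟨hik, Or.inl (hle k hkj)⟩)]; simp [X, hkj]

theorem vergeModule_toSubmodule (θ : AddChar F ℂ) {i j : Fin (size t n)}
    (hij : (i, j) ∈ rootPos t n) {α : F} (hα : α ≠ 0) :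
    (vergeModule θ (rootElem hij α)).toSubmodule = Finsupp.supported ℂ ℂ (rowSet i j α) := by
  change Finsupp.supported ℂ ℂ _ = _
  congr 1
  ext B
  exact verge_eq_iff hij hα

theorem finrank_supported {κ : Type*} [Finite κ] (s : Set κ) :
    Module.finrank ℂ (Finsupp.supported ℂ ℂ s) = Nat.card s := by
  classical
  let _ : Fintype s := Fintype.ofFinite s
  rw [(Finsupp.supportedEquivFinsupp s).finrank_eq, Module.finrank_finsupp_self,
    Nat.card_eq_fintype_card]

variable [Finite F]

theorem card_pi_le_card_rowSet {i j : Fin (size t n)} (hij : (i, j) ∈ rootPos t n) (α : F) :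
    Nat.card ({k : Fin (size t n) // i < k ∧ k < j} → F) ≤ Nat.card (rowSet i j α) := by
  classical
  choose B hB hBk using fun f : {k : Fin (size t n) // i < k ∧ k < j} → F =>
    exists_mem_rowSet hij α fun k => if h : i < k ∧ k < j then f ⟨k, h⟩ else 0
  refine Nat.card_le_card_of_injective (fun f => (⟨B f, hB f⟩ : rowSet i j α)) fun f g h => ?_
  funext k
  have h1 := hBk f k k.2.1 k.2.2
  have h2 := hBk g k k.2.1 k.2.2
  rw [dif_pos k.2] at h1 h2
  rw [← h1, ← h2, Subtype.mk.inj h]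

/-- The columns strictly between i and j enumerate ϱ: column k stands for (i,k) if that position is
removed, and for (j̄, k̄) otherwise. -/
theorem finrank_le_card_rowSet (hF : (2 : F) ≠ 0) {θ : AddChar F ℂ} {i j : Fin (size t n)}
    (hij : (i, j) ∈ rootPos t n) (hj : j < i.rev) {α : F}
    {M : Type*} [AddCommGroup M] [Module ℂ M] [FiniteDimensional ℂ M]
    {ρ : Representation ℂ (sylowU t n F)ᵐᵒᵖ M}
    (hρ : ∀ u : sylowU t n F, ρ.character (MulOpposite.op u) = elementaryCharacter θ hij α u) :
    Module.finrank ℂ M ≤ Nat.card (rowSet i j α) := by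
  classical
  refine le_trans ?_ (card_pi_le_card_rowSet hij α)
  refine finrank_le_of_character hF hij hρ
    (fun k => if (i, k.1) ∈ removed i j then (i, k.1) else (j.rev, k.1.rev)) ?_
  rintro ⟨a, b⟩ hab
  obtain ⟨hr, h⟩ := mem_removed.1 hab
  have hs := size_nTilde t n
  have hlt := lt_of_mem_rootPos hr
  by_cases ha : a = i
  · subst ha
    have hb : b < j := by
      rw [Fin.lt_def] at hj hlt ⊢
      rw [Fin.val_rev] at hj
      rcases h with h | ⟨h, h' | ⟨h', _⟩⟩
      · exact h.2.2
      · omega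
      · have := congrArg Fin.val h'
        rw [Fin.val_rev] at this
        omega
    exact ⟨⟨b, hlt, hb⟩, if_pos hab⟩
  · have h' : nTilde t n ≤ (j : ℕ) ∧ a = j.rev ∧ (b : ℕ) < nTilde t n := by tauto
    obtain ⟨hjn, rfl, hb⟩ := h'
    have hi := lt_of_mem_rootPos hij
    have hib : i < b.rev := by
      rw [Fin.lt_def] at hj hi ⊢
      rw [Fin.val_rev] at hj ⊢
      omega
    have hbj : b.rev < j := by rw [← Fin.rev_rev j]; exact Fin.rev_lt_rev.2 hlt
    refine ⟨⟨b.rev, hib, hbj⟩, ?_⟩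
    rw [if_neg, Fin.rev_rev]
    intro hmem
    obtain ⟨_, h | ⟨_, h | h⟩⟩ := mem_removed.1 hmem
    · omega
    · have := h.2
      rw [Fin.val_rev] at this
      omega
    · exact ha h.1.symm

/-- A module which affords an elementary character is the module spanned by `rowSet i j α`, if the
orbits in this set are represented by elements of `leftRowSet i j α`. -/
theorem nonempty_equiv_vergeModule (hF : (2 : F) ≠ 0) {θ : AddChar F ℂ} (hθ : θ ≠ 1)
    {i j : Fin (size t n)} (hij : (i, j) ∈ rootPos t n) (hj : j < i.rev) {α : F} (hα : α ≠ 0)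
    {M : Type*} [AddCommGroup M] [Module ℂ M] [FiniteDimensional ℂ M]
    {ρ : Representation ℂ (sylowU t n F)ᵐᵒᵖ M}
    (hρ : ∀ u : sylowU t n F, ρ.character (MulOpposite.op u) = elementaryCharacter θ hij α u)
    {ι : Type*} [Finite ι] (A : ι → rootSpace t n F) (hA : ∀ k, A k ∈ leftRowSet i j α)
    (hcover : ∀ B ∈ rowSet i j α, ∃ k, B ∈ orbit (A k))
    (hdisj : Pairwise (Function.onFun Disjoint fun k => orbit (A k))) :
    Nonempty (ρ.Equiv (vergeModule θ (rootElem hij α)).toRepresentation) := by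
  classical
  let _ : Fintype ι := Fintype.ofFinite ι
  -- Frobenius reciprocity converts the eigenvector in each orbit module into a nonzero map from M.
  have hex : ∀ k, ∃ f : ρ.IntertwiningMap (orbitModule θ (A k)).toRepresentation, f ≠ 0 := fun k =>
    (Representation.exists_intertwiningMap_ne_zero_iff hρ _).2
      (exists_eigenvector_orbitModule θ hij (hA k))
  choose f hf using hex
  have hsub : ∀ k, (orbitModule θ (A k)).toSubmodule ≤
      (vergeModule θ (rootElem hij α)).toSubmodule := fun k => by
    rw [vergeModule_toSubmodule θ hij hα]
    exact Finsupp.supported_mono (orbit_subset_rowSet (hA k).1)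
  let g : M →ₗ[ℂ] (vergeModule θ (rootElem hij α)).toSubmodule :=
    ∑ k, Submodule.inclusion (hsub k) ∘ₗ (f k).toLinearMap
  have hg : ∀ m, (g m : rootSpace t n F →₀ ℂ) = ∑ k, (f k m : rootSpace t n F →₀ ℂ) := by
    intro m
    simp [g, LinearMap.sum_apply]
  have hginv : ∀ u m, (g (ρ u m) : rootSpace t n F →₀ ℂ) = monomialRep θ u (g m) := by
    intro u m
    rw [hg, hg, map_sum]
    refine Finset.sum_congr rfl fun k _ => ?_
    rw [Representation.IntertwiningMap.isIntertwining]
    rfl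
  set P := (LinearMap.range g).map (vergeModule θ (rootElem hij α)).toSubmodule.subtype
  have hP : ∀ u, ∀ x ∈ P, monomialRep θ u x ∈ P := by
    rintro u _ ⟨_, ⟨m, rfl⟩, rfl⟩
    exact ⟨_, ⟨ρ u m, rfl⟩, hginv u m⟩
  have hle : P ≤ Finsupp.supported ℂ ℂ (rowSet i j α) := by
    rw [← vergeModule_toSubmodule θ hij hα]
    exact Submodule.map_subtype_le _ _
  have hsingle : ∀ B ∈ rowSet i j α, Finsupp.single B (1 : ℂ) ∈ P := by
    intro B hB
    obtain ⟨k, hk⟩ := hcover B hB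
    obtain ⟨m, hm⟩ : ∃ m, f k m ≠ 0 := by
      by_contra! h
      exact hf k (Representation.IntertwiningMap.ext (LinearMap.ext h))
    obtain ⟨C, hC⟩ := Finsupp.ne_iff.1 fun h : (f k m : rootSpace t n F →₀ ℂ) = 0 =>
      hm (Subtype.ext h)
    have hCk : C ∈ orbit (A k) := (f k m).2 (Finsupp.mem_support_iff.2 hC)
    -- The orbits are disjoint, so no other summand of g can cancel this coefficient. The image
    -- therefore contains a basis vector from each orbit, hence all of them.
    have hgC : (g m : rootSpace t n F →₀ ℂ) C ≠ 0 := by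
      rw [hg, Finsupp.finsetSum_apply, Finset.sum_eq_single k]
      · exact hC
      · intro l _ hl
        by_contra h
        exact Set.disjoint_left.1 (hdisj hl) ((f l m).2 (Finsupp.mem_support_iff.2 h)) hCk
      · simp
    exact single_mem_of_mem_orbit hP
      (single_mem_of_apply_ne_zero hF hθ hj hP hle ⟨_, ⟨m, rfl⟩, rfl⟩ hgC) hCk hk
  have hsurj : Function.Surjective g := by
    intro y
    have hy : (y : rootSpace t n F →₀ ℂ) ∈ P := by
      have h1 : Finsupp.supported ℂ ℂ (rowSet i j α) ≤ P := by
        rw [Finsupp.supported_eq_span_single, Submodule.span_le]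
        rintro _ ⟨B, hB, rfl⟩
        exact hsingle B hB
      exact h1 (vergeModule_toSubmodule θ hij hα ▸ y.2)
    obtain ⟨_, ⟨m, rfl⟩, hm⟩ := hy
    exact ⟨m, Subtype.ext hm⟩
  have hfin : Module.finrank ℂ M =
      Module.finrank ℂ (vergeModule θ (rootElem hij α)).toSubmodule := by
    refine le_antisymm ?_ (LinearMap.finrank_le_finrank_of_surjective hsurj)
    rw [vergeModule_toSubmodule θ hij hα, finrank_supported]
    exact finrank_le_card_rowSet hF hij hj hρ
  have hinj := (LinearMap.injective_iff_surjective_of_finrank_eq_finrank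
    (V₂ := (vergeModule θ (rootElem hij α)).toSubmodule) (f := g) hfin).2 hsurj
  let g' : ρ.IntertwiningMap (vergeModule θ (rootElem hij α)).toRepresentation :=
    ⟨g, fun u => LinearMap.ext fun m => Subtype.ext (hginv u m)⟩
  exact ⟨g'.ofBijective ⟨hinj, hsurj⟩⟩

end Main

/-! ### The antidiagonal positions in type ℭ. -/

section LongRoots

variable {n : ℕ} {F : Type*} [Field F]

/-- For j = ī one has j̄ = i and ñ = n, so the two families in ϱ coincide. -/
theorem mem_removed_long {i a b : Fin (size .C n)} (hi : i < i.rev) :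
    (a, b) ∈ removed i i.rev ↔ a = i ∧ i < b ∧ (b : ℕ) < n := by
  have hn := val_lt_of_lt_rev rfl hi
  have hs : size .C n = 2 * n ∧ nTilde .C n = n := by simp [size, nTilde]
  have ha := a.2
  have hb := b.2
  rw [mem_removed, mem_rootPos]
  simp only [Fin.rev_rev, Fin.ext_iff, Fin.lt_def, Fin.val_rev, true_and]
  omega

theorem linearCharacter_inv_eq_one {t : DynkinType} (θ : AddChar F ℂ) {i j : Fin (size t n)}
    (hij : (i, j) ∈ rootPos t n) (α : F) {v : sylowU t n F} (hv : v ∈ elementarySubgroup F i j)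
    (hvij : toMat v i j = 0) : linearCharacter θ hij α ⟨v⁻¹, inv_mem hv⟩ = 1 := by
  have h1 := entry_add hij hv (inv_mem hv)
  rw [mul_inv_cancel, toMat_one, Matrix.one_apply_ne (lt_of_mem_rootPos hij).ne, hvij,
    zero_add] at h1
  change θ (α * toMat v⁻¹ i j) = 1
  rw [← h1, mul_zero, AddChar.map_zero_eq_one]

/-- The short root elements in the right half of row `i` act on `rowSet i i.rev α` by
translations. -/
theorem exists_translation (hF : (2 : F) ≠ 0) (θ : AddChar F ℂ) {i k : Fin (size .C n)}
    (hi : i < i.rev) (hk : n ≤ (k : ℕ)) (hki : k < i.rev) (μ : F) :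
    ∃ v ∈ elementarySubgroup F i i.rev, toMat v i i.rev = 0 ∧
      ∀ α : F, ∀ B ∈ rowSet i i.rev α,
        (∀ r, i < r → (dot B v⁻¹ : Mat .C n F) i r =
          (B : Mat .C n F) i r + if r = k.rev then α * μ else 0) ∧
        coeff θ B v⁻¹ = θ (-((B : Mat .C n F) i k * μ)) := by
  have hn := val_lt_of_lt_rev rfl hi
  have hik : i < k := Fin.lt_def.2 (by omega)
  have hkk : k ≠ k.rev := fun h => by simpa using eq_B_of_eq_rev h
  have hkri : k.rev ≠ i := fun h => hki.ne (by rw [← h, Fin.rev_rev])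
  -- The entry μ at (k̄, ī) meets the pivot α and translates column k̄ by αμ; the entry μ at (i,k)
  -- is seen only by the coefficient.
  obtain ⟨v, hv⟩ := exists_toMat_short hik hi.ne hkk μ
  have h1 : formSign .C n F i = 1 := by simp [formSign]; omega
  have h2 : formSign .C n F k = -1 := by simp [formSign, hk]
  rw [h1, h2, one_mul, neg_one_mul, ← Matrix.single_neg, sub_neg_eq_add] at hv
  have hrow : ∀ l, toMat v i l = (1 : Mat .C n F) i l + if k = l then μ else 0 := fun l => by
    simp [hv, hkri, Matrix.single_apply]
  refine ⟨v, ?_, ?_, fun α B hB => ⟨fun r hr => ?_, ?_⟩⟩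
  · rw [mem_elementarySubgroup_iff hF]
    rintro ⟨a, b⟩ hab
    obtain ⟨rfl, hab, hbn⟩ := (mem_removed_long hi).1 hab
    have : k ≠ b := fun h => by rw [← h] at hbn; omega
    simp [hrow, hab.ne, this]
  · rw [hrow, Matrix.one_apply_ne hi.ne, if_neg hki.ne, add_zero]
  · rw [dot_row_of_trivial hB hr fun l hl => ?_]
    · congr 1
      simp only [hv, Matrix.add_apply, Matrix.single_apply, hr.ne, false_and, if_false, zero_add,
        and_true, add_sub_cancel_left, mul_ite, mul_zero, eq_comm]
    · simp [hv, hr.ne, hl.ne']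
  · rw [coeff_row θ hB, inv_inv, Finset.sum_eq_single k]
    · rw [hrow, Matrix.one_apply_ne hik.ne, if_pos rfl, zero_add]
    · intro l _ hl
      rcases eq_or_ne l i with rfl | hli
      · rw [apply_eq_zero_of_le B le_rfl, zero_mul]
      · rw [hrow, Matrix.one_apply_ne hli.symm, if_neg hl.symm, add_zero, mul_zero]
    · simp

/-- The long root elements below row `i` act on `rowSet i i.rev α` by transvections. -/
theorem exists_transvection (hF : (2 : F) ≠ 0) (θ : AddChar F ℂ) {i k : Fin (size .C n)}
    (hi : i < i.rev) (hk : n ≤ (k : ℕ)) (hki : k < i.rev) (ν : F) :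
    ∃ v ∈ elementarySubgroup F i i.rev, toMat v i i.rev = 0 ∧
      ∀ α : F, ∀ B ∈ rowSet i i.rev α,
        (∀ r, i < r → (dot B v⁻¹ : Mat .C n F) i r =
          (B : Mat .C n F) i r + if r = k.rev then (B : Mat .C n F) i k * ν else 0) ∧
        coeff θ B v⁻¹ = 1 := by
  have hkl : i < k.rev := by rw [← Fin.rev_rev i]; exact Fin.rev_lt_rev.2 hki
  have hkk : k.rev < k.rev.rev := by
    have hs : size .C n = 2 * n := by simp [size]
    have := k.2
    rw [Fin.rev_rev, Fin.lt_def, Fin.val_rev]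
    omega
  obtain ⟨v, hv⟩ := exists_toMat_long rfl hkk ν
  rw [Fin.rev_rev] at hv
  have hrow : ∀ l, toMat v i l = (1 : Mat .C n F) i l := fun l => by
    simp [hv, hkl.ne']
  refine ⟨v, ?_, ?_, fun α B hB => ⟨fun r hr => ?_, ?_⟩⟩
  · rw [mem_elementarySubgroup_iff hF]
    rintro ⟨a, b⟩ hab
    obtain ⟨rfl, hab, hbn⟩ := (mem_removed_long hi).1 hab
    simp [hrow, hab.ne]
  · rw [hrow, Matrix.one_apply_ne hi.ne]
  · rw [dot_row B v hr, hv]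
    simp only [Matrix.add_apply, mul_add, Finset.sum_add_distrib, Matrix.one_apply,
      Matrix.single_apply]
    by_cases h : r = k.rev
    · simp [h]
    · simp [h, Ne.symm h]
  · rw [coeff_row θ hB, inv_inv]
    simp [hrow, Matrix.one_apply, apply_eq_zero_of_le B le_rfl]

theorem rootElem_mem_leftRowSet {t : DynkinType} {i j : Fin (size t n)}
    (hij : (i, j) ∈ rootPos t n) (α : F) : rootElem hij α ∈ leftRowSet i j α :=
  ⟨rootElem_mem_rowSet hij α, fun k _ hk => by rw [rootElem_apply, if_neg fun h => hk.ne' h.2]⟩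

/-- The subgroup `U_{i,ī}` is transitive on `leftRowSet i i.rev α`. -/
theorem exists_dot_eq_rootElem (hF : (2 : F) ≠ 0) {i : Fin (size .C n)}
    (hij : (i, i.rev) ∈ rootPos .C n) {α : F} (hα : α ≠ 0) {B : rootSpace .C n F}
    (hB : B ∈ leftRowSet i i.rev α) :
    ∃ h ∈ elementarySubgroup F i i.rev, dot B h = rootElem hij α := by
  have hi := lt_rev_of_mem_rootPos hij
  have hs : size .C n = 2 * n := by simp [size]
  have key : ∀ T : Finset (Fin (size .C n)), ∃ h ∈ elementarySubgroup F i i.rev,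
      ∀ k ∈ T, (k : ℕ) < n → (dot B h : Mat .C n F) i k = 0 := by
    intro T
    induction T using Finset.induction_on with
    | empty => exact ⟨1, one_mem _, by simp⟩
    | insert k T hkT ih =>
      obtain ⟨h, hh, hT⟩ := ih
      by_cases hk : i < k ∧ (k : ℕ) < n
      · have hkn : n ≤ (k.rev : ℕ) := by rw [Fin.val_rev]; omega
        -- The translation belonging to k̄ clears column k and changes no other column right of i.
        -- Only the action on entries matters, so the trivial additive character may be used.
        obtain ⟨v, hvH, -, hv⟩ := exists_translation hF 1 hi hkn (Fin.rev_lt_rev.2 hk.1)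
          (-((dot B h : Mat .C n F) i k / α))
        have hv := (hv α _ (dot_mem_rowSet hB.1 h)).1
        refine ⟨h * v⁻¹, mul_mem hh (inv_mem hvH), fun l hl hln => ?_⟩
        rw [dot_mul]
        rcases le_or_gt l i with hli | hli
        · exact apply_eq_zero_of_le _ hli
        rw [hv l hli, Fin.rev_rev]
        rcases Finset.mem_insert.1 hl with rfl | hl
        · rw [if_pos rfl]; field_simp; ring
        · rw [if_neg fun h : l = k => hkT (h ▸ hl), hT l hl hln, add_zero]
      · refine ⟨h, hh, fun l hl hln => ?_⟩
        rcases Finset.mem_insert.1 hl with rfl | hl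
        · exact apply_eq_zero_of_le _ (not_lt.1 fun h' => hk ⟨h', hln⟩)
        · exact hT l hl hln
  obtain ⟨h, hh, hT⟩ := key Finset.univ
  have hA := rootElem_mem_leftRowSet hij α
  refine ⟨h, hh, rowSet_ext (dot_mem_rowSet hB.1 h) hA.1 fun k _ hkj => ?_⟩
  rw [rootElem_apply, if_neg fun h => hkj.ne' h.2]
  rcases lt_or_ge (k : ℕ) n with hk | hk
  · exact hT k (Finset.mem_univ k) hk
  · exact (dot_mem_leftRowSet hB hh).2 k hk hkj

theorem linearCharacter_ne_zero {t : DynkinType} (θ : AddChar F ℂ) {i j : Fin (size t n)}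
    (hij : (i, j) ∈ rootPos t n) (α : F) (h : elementarySubgroup F i j) :
    linearCharacter θ hij α h ≠ 0 := (AddChar.val_isUnit θ _).ne_zero

theorem orbitModule_long_toSubmodule (hF : (2 : F) ≠ 0) (θ : AddChar F ℂ) {i : Fin (size .C n)}
    (hij : (i, i.rev) ∈ rootPos .C n) {α : F} (hα : α ≠ 0) :
    (orbitModule θ (rootElem hij α)).toSubmodule =
      Finsupp.supported ℂ ℂ (rowSet i i.rev α) := by
  change Finsupp.supported ℂ ℂ _ = _
  rw [orbit_rootElem hF hij (Or.inl rfl) hα]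

variable [Finite F]

/-- The vectors of `ℂ𝒪_A`, `A = α e_{i,ī}`, on which `U_{i,ī}` acts through its linear character are
the multiples of one vector. -/
theorem eq_smul_basisSum (hF : (2 : F) ≠ 0) {θ : AddChar F ℂ} (hθ : θ ≠ 1) {i : Fin (size .C n)}
    (hij : (i, i.rev) ∈ rootPos .C n) {α : F} (hα : α ≠ 0) {x : rootSpace .C n F →₀ ℂ}
    (hx : x ∈ Finsupp.supported ℂ ℂ (rowSet i i.rev α))
    (hχ : ∀ h : elementarySubgroup F i i.rev, monomialRep θ (MulOpposite.op (h : sylowU .C n F)) x =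
      linearCharacter θ hij α h • x) :
    x = x (rootElem hij α) • basisSum (leftRowSet i i.rev α) := by
  classical
  have hi := lt_rev_of_mem_rootPos hij
  have hdot : ∀ (h : elementarySubgroup F i i.rev) (B : rootSpace .C n F),
      x B * coeff θ B (h : sylowU .C n F) =
        linearCharacter θ hij α h * x (dot B (h : sylowU .C n F)) := by
    intro h B
    rw [← monomialRep_apply_dot, hχ h, Finsupp.smul_apply, smul_eq_mul]
  have hzero : ∀ B, x B ≠ 0 → B ∈ leftRowSet i i.rev α := by
    intro B hB
    have hBrow : B ∈ rowSet i i.rev α := hx (Finsupp.mem_support_iff.2 hB)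
    refine ⟨hBrow, fun k hk hki => ?_⟩
    by_contra hBk
    obtain ⟨μ, hμ⟩ := exists_map_mul_ne_one hθ (neg_ne_zero.2 hBk)
    obtain ⟨v, hvH, hv0, hv⟩ := exists_translation hF θ hi hk hki μ
    -- The parameter makes the transvection add the same αμ to column k̄ as the translation. Both
    -- elements have trivial linear character, but the coefficients are 1 and θ(-B_ik μ) ≠ 1, which
    -- contradicts x B ≠ 0.
    obtain ⟨w, hwH, hw0, hw⟩ := exists_transvection hF θ hi hk hki (α * μ / (B : Mat .C n F) i k)
    obtain ⟨hv1, hv2⟩ := hv α B hBrow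
    obtain ⟨hw1, hw2⟩ := hw α B hBrow
    have heq : dot B v⁻¹ = dot B w⁻¹ := by
      refine rowSet_ext (dot_mem_rowSet hBrow _) (dot_mem_rowSet hBrow _) fun r hr _ => ?_
      rw [hv1 r hr, hw1 r hr, mul_div_cancel₀ _ hBk]
    have e1 := hdot ⟨v⁻¹, inv_mem hvH⟩ B
    have e2 := hdot ⟨w⁻¹, inv_mem hwH⟩ B
    rw [linearCharacter_inv_eq_one θ hij α hvH hv0, hv2, one_mul] at e1
    rw [linearCharacter_inv_eq_one θ hij α hwH hw0, hw2, one_mul, mul_one] at e2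
    rw [heq, ← e2, mul_eq_left₀ hB] at e1
    exact hμ (by rw [mul_neg, mul_comm]; exact e1)
  ext B
  rw [Finsupp.smul_apply, smul_eq_mul, basisSum_apply]
  by_cases hB : B ∈ leftRowSet i i.rev α
  · obtain ⟨h, hh, hBh⟩ := exists_dot_eq_rootElem hF hij hα hB
    have e := hdot ⟨h, hh⟩ B
    rw [hBh, coeff_leftRowSet θ hij hB ⟨h, hh⟩, mul_comm] at e
    rw [if_pos hB, mul_one]
    exact mul_left_cancel₀ (linearCharacter_ne_zero θ hij α _) e
  · rw [if_neg hB, mul_zero]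
    exact by_contra fun h => hB (hzero B h)

/-- The dimension of an invariant submodule which contains the sum over `leftRowSet i i.rev α`. -/
theorem card_pi_le_finrank (hF : (2 : F) ≠ 0) {θ : AddChar F ℂ} {i : Fin (size .C n)}
    (hij : (i, i.rev) ∈ rootPos .C n) {α : F} (hα : α ≠ 0)
    {P : Submodule ℂ (rootSpace .C n F →₀ ℂ)} (hP : ∀ u, ∀ x ∈ P, monomialRep θ u x ∈ P)
    (hmem : basisSum (leftRowSet i i.rev α) ∈ P) :
    Nat.card ({k : Fin (size .C n) // i < k ∧ (k : ℕ) < n} → F) ≤ Module.finrank ℂ P := by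
  classical
  have hi := lt_rev_of_mem_rootPos hij
  have hs : size .C n = 2 * n := by simp [size]
  have hA := rootElem_mem_leftRowSet hij α
  let ι := {k : Fin (size .C n) // i < k ∧ (k : ℕ) < n}
  let _ : Fintype (ι → F) := Fintype.ofFinite _
  -- C R is an orbit element whose right half of row i is prescribed by R; u R will move [A] to it.
  choose C hC hCk using fun R : ι → F => exists_mem_rowSet hij α fun k =>
    if h : i < k.rev ∧ (k.rev : ℕ) < n then R ⟨k.rev, h⟩ else 0
  have hCR : ∀ R, ∀ k : ι, (C R : Mat .C n F) i (k : Fin (size .C n)).rev = R k := by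
    intro R k
    have h1 := hCk R (k : Fin (size .C n)).rev (by
      have h2 := Fin.lt_def.1 k.2.1
      have h3 := k.2.2
      rw [Fin.lt_def, Fin.val_rev]
      omega) (Fin.rev_lt_rev.2 k.2.1)
    simp only [Fin.rev_rev] at h1
    rw [h1, dif_pos k.2]
  have hu : ∀ R, ∃ u, dot (rootElem hij α) u = C R := fun R => by
    have := hC R
    rwa [← orbit_rootElem hF hij (Or.inl rfl) hα] at this
  choose u hu using hu
  -- The right half of row i of B.v depends on v alone. Hence the translates of the basis sum by the
  -- u R have disjoint supports, distinguished by R, and are linearly independent.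
  have hright : ∀ B ∈ leftRowSet i i.rev α, ∀ v : sylowU .C n F, ∀ k : ι,
      (dot B v : Mat .C n F) i (k : Fin (size .C n)).rev =
        α * toMat v⁻¹ (k : Fin (size .C n)).rev i.rev := by
    intro B hB v k
    have h2 := Fin.lt_def.1 k.2.1
    have h3 := k.2.2
    have hkn : n ≤ ((k : Fin (size .C n)).rev : ℕ) := by rw [Fin.val_rev]; omega
    rw [← inv_inv v, dot_row B v⁻¹ (Fin.lt_def.2 (by omega)), inv_inv, Finset.sum_eq_single i.rev]
    · rw [hB.1.2.1]
    · intro l _ hl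
      rcases lt_or_gt_of_ne hl with hl | hl
      · rcases lt_or_ge l (k : Fin (size .C n)).rev with h1 | h1
        · rw [toMat_lower _ h1, mul_zero]
        · rw [hB.2 l (hkn.trans h1) hl, zero_mul]
      · rw [hB.1.2.2 l hl, zero_mul]
    · simp
  let w : (ι → F) → P := fun R => ⟨_, hP (MulOpposite.op (u R)) _ hmem⟩
  have hw : ∀ R R', (w R : rootSpace .C n F →₀ ℂ) (C R') ≠ 0 ↔ R = R' := by
    intro R R'
    change monomialRep θ (MulOpposite.op (u R)) (basisSum (leftRowSet i i.rev α)) (C R') ≠ 0 ↔ _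
    constructor
    · intro h
      rw [← dot_inv_dot (C R') (u R), monomialRep_apply_dot, basisSum_apply] at h
      have hB : dot (C R') (u R)⁻¹ ∈ leftRowSet i i.rev α := by
        by_contra hB
        rw [if_neg hB, zero_mul] at h
        exact h rfl
      funext k
      rw [← hCR R k, ← hCR R' k, ← hu R, hright _ hA, ← hright _ hB (u R) k, dot_inv_dot]
    · rintro rfl
      rw [← hu R, monomialRep_apply_dot, basisSum_apply, if_pos hA, one_mul]
      exact coeff_ne_zero _ _ _
  have hli : LinearIndependent ℂ w := by
    refine (Fintype.linearIndependent_iff (R := ℂ) (M := P)).2 fun g hg R => ?_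
    have h1 := DFunLike.congr_fun (congrArg Subtype.val hg) (C R)
    simp only [Submodule.coe_sum, Submodule.coe_smul, Finsupp.finsetSum_apply, Finsupp.smul_apply,
      smul_eq_mul, ZeroMemClass.coe_zero, Finsupp.coe_zero, Pi.zero_apply] at h1
    rw [Finset.sum_eq_single R] at h1
    · exact (mul_eq_zero.1 h1).resolve_right ((hw R R).2 rfl)
    · intro R' _ hR'
      rw [not_ne_iff.1 fun h => hR' ((hw R' R).1 h), mul_zero]
    · simp
  rw [Nat.card_eq_fintype_card]
  exact hli.fintype_card_le_finrank

variable {θ : AddChar F ℂ} {i : Fin (size .C n)} (hij : (i, i.rev) ∈ rootPos .C n) {α : F}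
  {M : Type*} [AddCommGroup M] [Module ℂ M] [FiniteDimensional ℂ M]
  {ρ : Representation ℂ (sylowU .C n F)ᵐᵒᵖ M}

theorem injective_of_ne_zero (hF : (2 : F) ≠ 0) (hθ : θ ≠ 1) (hα : α ≠ 0)
    (hρ : ∀ u : sylowU .C n F, ρ.character (MulOpposite.op u) = elementaryCharacter θ hij α u)
    (f : ρ.IntertwiningMap (orbitModule θ (rootElem hij α)).toRepresentation) (hf : f ≠ 0) :
    Function.Injective f := by
  classical
  have hi := lt_rev_of_mem_rootPos hij
  let f' : M →ₗ[ℂ] rootSpace .C n F →₀ ℂ :=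
    (orbitModule θ (rootElem hij α)).toSubmodule.subtype ∘ₗ f.toLinearMap
  have hf' : ∀ u m, f' (ρ u m) = monomialRep θ u (f' m) := fun u m =>
    congrArg Subtype.val (Representation.IntertwiningMap.isIntertwining _ _ f u m)
  -- Frobenius reciprocity is applied to the image of f, so that the eigenvector found lies in that
  -- image.
  let S : Subrepresentation (monomialRep (t := .C) (n := n) θ) :=
    { toSubmodule := LinearMap.range f'
      apply_mem_toSubmodule := by
        rintro u _ ⟨m, rfl⟩
        exact ⟨ρ u m, hf' u m⟩ }
  let g : ρ.IntertwiningMap S.toRepresentation :=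
    ⟨f'.rangeRestrict, fun u => LinearMap.ext fun m => Subtype.ext (hf' u m)⟩
  have hg : g ≠ 0 := by
    intro h
    refine hf (Representation.IntertwiningMap.ext (LinearMap.ext fun m => Subtype.ext ?_))
    exact congrArg (fun k : ρ.IntertwiningMap S.toRepresentation =>
      ((k m : S.toSubmodule) : rootSpace .C n F →₀ ℂ)) h
  obtain ⟨x, hx, hx0⟩ := (Representation.exists_intertwiningMap_ne_zero_iff
    (W := S.toSubmodule) hρ S.toRepresentation).1 ⟨g, hg⟩
  have hxS : (x : rootSpace .C n F →₀ ℂ) ∈ LinearMap.range f' := x.2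
  have hsupp : (x : rootSpace .C n F →₀ ℂ) ∈ Finsupp.supported ℂ ℂ (rowSet i i.rev α) := by
    obtain ⟨m, hm⟩ := hxS
    rw [← hm, ← orbitModule_long_toSubmodule hF θ hij hα]
    exact (f m).2
  have hxe := eq_smul_basisSum hF hθ hij hα hsupp fun h => congrArg Subtype.val (hx h)
  have hc : (x : rootSpace .C n F →₀ ℂ) (rootElem hij α) ≠ 0 := by
    intro h
    rw [h, zero_smul] at hxe
    exact hx0 (Subtype.ext hxe)
  have hb : basisSum (leftRowSet i i.rev α) ∈ LinearMap.range f' := by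
    rw [hxe] at hxS
    exact (Submodule.smul_mem_iff _ hc).1 hxS
  have h1 : Nat.card ({k : Fin (size .C n) // i < k ∧ (k : ℕ) < n} → F) ≤
      Module.finrank ℂ (LinearMap.range f') :=
    card_pi_le_finrank hF hij hα (fun u y hy => S.apply_mem_toSubmodule u hy) hb
  have h2 : Module.finrank ℂ M ≤
      Nat.card ({k : Fin (size .C n) // i < k ∧ (k : ℕ) < n} → F) := by
    refine finrank_le_of_character hF hij hρ (fun k => (i, k.1)) ?_
    rintro ⟨a, b⟩ hab
    obtain ⟨rfl, h⟩ := (mem_removed_long hi).1 hab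
    exact ⟨⟨b, h⟩, rfl⟩
  -- The translates of the eigenvector fill at least q^|ϱ| dimensions of the image, and dim M is at
  -- most that; no room is left for a kernel.
  have h3 := f'.finrank_range_add_finrank_ker
  have h4 : LinearMap.ker f' = ⊥ := Submodule.finrank_eq_zero.1 (by omega)
  exact Function.Injective.of_comp (f := Subtype.val) (LinearMap.ker_eq_bot.1 h4)

theorem eq_smul_basisSum_of_mem_eigenvectors (hF : (2 : F) ≠ 0) (hθ : θ ≠ 1) (hα : α ≠ 0)
    {y : (orbitModule θ (rootElem hij α)).toSubmodule}
    (hy : y ∈ Representation.eigenvectors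
      (W := (orbitModule θ (rootElem hij α)).toSubmodule)
      (orbitModule θ (rootElem hij α)).toRepresentation (elementarySubgroup F i i.rev)
      (linearCharacter θ hij α)) : (y : rootSpace .C n F →₀ ℂ) =
        (y : rootSpace .C n F →₀ ℂ) (rootElem hij α) • basisSum (leftRowSet i i.rev α) := by
  refine eq_smul_basisSum hF hθ hij hα ?_ fun h => congrArg Subtype.val (hy h)
  rw [← orbitModule_long_toSubmodule hF θ hij hα]
  exact y.2

theorem finrank_intertwiningMap_long (hF : (2 : F) ≠ 0) (hθ : θ ≠ 1) (hα : α ≠ 0)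
    (hρ : ∀ u : sylowU .C n F, ρ.character (MulOpposite.op u) = elementaryCharacter θ hij α u) :
    Module.finrank ℂ
      (ρ.IntertwiningMap (orbitModule θ (rootElem hij α)).toRepresentation) = 1 := by
  obtain ⟨x, hx, hx0⟩ := exists_eigenvector_orbitModule θ hij (rootElem_mem_leftRowSet hij α)
  have hx' := eq_smul_basisSum_of_mem_eigenvectors hij hF hθ hα hx
  have hc : (x : rootSpace .C n F →₀ ℂ) (rootElem hij α) ≠ 0 := by
    intro h
    rw [h, zero_smul] at hx'
    exact hx0 (Subtype.ext hx')
  refine Representation.finrank_intertwiningMap_eq_one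
    (W := (orbitModule θ (rootElem hij α)).toSubmodule) hρ hx hx0 fun y hy => ?_
  refine ⟨(y : rootSpace .C n F →₀ ℂ) (rootElem hij α) *
    ((x : rootSpace .C n F →₀ ℂ) (rootElem hij α))⁻¹, Subtype.ext ?_⟩
  refine Eq.trans ?_ (eq_smul_basisSum_of_mem_eigenvectors hij hF hθ hα hy).symm
  refine (congrArg (((y : rootSpace .C n F →₀ ℂ) (rootElem hij α) *
    ((x : rootSpace .C n F →₀ ℂ) (rootElem hij α))⁻¹) • ·) hx').trans ?_
  rw [smul_smul, mul_assoc, inv_mul_cancel₀ hc, mul_one]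

theorem isIrreducible_long (hF : (2 : F) ≠ 0) (hθ : θ ≠ 1) (hα : α ≠ 0)
    (hρ : ∀ u : sylowU .C n F, ρ.character (MulOpposite.op u) = elementaryCharacter θ hij α u) :
    ρ.IsIrreducible := by
  have : Finite (sylowU .C n F)ᵐᵒᵖ := Finite.of_equiv _ MulOpposite.opEquiv
  refine Representation.isIrreducible_of_forall_injective
    ((Representation.exists_intertwiningMap_ne_zero_iff hρ _).2
      (exists_eigenvector_orbitModule θ hij (rootElem_mem_leftRowSet hij α)))
    (injective_of_ne_zero hij hF hθ hα hρ)

end LongRoots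

/-! ### Mirror inequalities in the two triangles. -/

section Triangles

variable {t : DynkinType} {n : ℕ} {F : Type*} [Field F]

theorem le_rev_of_mem_leftTriangle {i j : Fin (size t n)} (h : (i, j) ∈ leftTriangle t n) :
    j ≤ j.rev := by
  have h1 := (Finset.mem_filter.1 h).2
  have hs := size_nTilde t n
  rw [Fin.le_def, Fin.val_rev]
  simp only at h1
  omega

theorem lt_rev_of_mem_leftTriangle {i j : Fin (size t n)} (h : (i, j) ∈ leftTriangle t n) :
    j < i.rev :=
  (le_rev_of_mem_leftTriangle h).trans_lt
    (Fin.rev_lt_rev.2 (lt_of_mem_rootPos (Finset.mem_filter.1 h).1))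

theorem rev_lt_of_mem_rightTriangle {i j : Fin (size t n)} (h : (i, j) ∈ rightTriangle t n) :
    j.rev < j ∧ (j.rev : ℕ) < n := by
  have h1 := (Finset.mem_filter.1 h).2
  have hs := size_nTilde t n
  have := j.2
  rw [Fin.lt_def, Fin.val_rev]
  simp only at h1
  omega

theorem minorElem_mem_leftRowSet (ht : t ≠ .C) {i j : Fin (size t n)}
    (hij : (i, j) ∈ rightTriangle t n) (α β : F) : minorElem ht hij α β ∈ leftRowSet i j α := by
  obtain ⟨hj, hjn⟩ := rev_lt_of_mem_rightTriangle hij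
  refine ⟨minorElem_mem_rowSet ht hij hj α β, fun k hk hkj => ?_⟩
  rw [minorElem_apply ht hij hj, if_neg, if_neg hkj.ne]
  rintro rfl
  omega

end Triangles

end ClassicalUnipotent

/-! ### The theorem, assembled from the three cases. -/

open ClassicalUnipotent in
theorem mainTheorem5 (t : DynkinType) (n : ℕ) {F : Type*} [Field F] [Finite F]
    (hF : ringChar F ≠ 2) (θ : AddChar F ℂ) (hθ : θ ≠ 1)
    {i j : Fin (size t n)} (hij : (i, j) ∈ rootPos t n) {α : F} (hα : α ≠ 0)
    {M : Type*} [AddCommGroup M] [Module ℂ M] [FiniteDimensional ℂ M]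
    (ρ : Representation ℂ (sylowU t n F)ᵐᵒᵖ M)
    (hρ : ∀ u : sylowU t n F, ρ.character (MulOpposite.op u) = elementaryCharacter θ hij α u) :
    ((i, j) ∈ leftTriangle t n ∨ (t = .C ∧ (i, j) ∈ upperPos t n) →
      ρ.IsIrreducible ∧
        Nonempty (ρ.Equiv (orbitModule θ (rootElem hij α)).toRepresentation)) ∧
    (∀ (ht : t ≠ .C) (hr : (i, j) ∈ rightTriangle t n),
      Nonempty (ρ.Equiv (vergeModule θ (rootElem hij α)).toRepresentation) ∧
      iSupIndep (fun β : F => (orbitModule θ (minorElem ht hr α β)).toSubmodule) ∧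
      (⨆ β : F, (orbitModule θ (minorElem ht hr α β)).toSubmodule) =
        (vergeModule θ (rootElem hij α)).toSubmodule ∧
      (∀ β : F, Representation.IsIrreducible (k := ℂ) (G := (sylowU t n F)ᵐᵒᵖ)
        (V := (orbitModule θ (minorElem ht hr α β)).toSubmodule)
        (orbitModule θ (minorElem ht hr α β)).toRepresentation) ∧
      ∀ β γ : F, β ≠ γ →
        IsEmpty ((orbitModule θ (minorElem ht hr α β)).toRepresentation.Equiv
          (orbitModule θ (minorElem ht hr α γ)).toRepresentation)) ∧
    (t = .C ∧ j = i.rev →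
      ρ.IsIrreducible ∧
        Module.finrank ℂ
          (ρ.IntertwiningMap (orbitModule θ (rootElem hij α)).toRepresentation) = 1) := by
  have h2 : (2 : F) ≠ 0 := Ring.two_ne_zero hF
  refine ⟨fun h => ?_, fun ht hr => ?_, ?_⟩
  · have hj : j < i.rev := by
      rcases h with h | h
      · exact lt_rev_of_mem_leftTriangle h
      · exact (Finset.mem_filter.1 h.2).2.2
    have horbit := orbit_rootElem h2 hij
      (h.elim (fun h => Or.inr (le_rev_of_mem_leftTriangle h)) fun h => Or.inl h.1) hα
    have heq : vergeModule θ (rootElem hij α) = orbitModule θ (rootElem hij α) := by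
      apply Subrepresentation.toSubmodule_injective
      rw [vergeModule_toSubmodule θ hij hα, ← horbit]
      rfl
    -- A single orbit fills the verge module here, so the family of representatives has one member.
    have he := nonempty_equiv_vergeModule h2 hθ hij hj hα hρ (fun _ : Unit => rootElem hij α)
      (fun _ => rootElem_mem_leftRowSet hij α) (fun B hB => ⟨(), horbit ▸ hB⟩)
      (fun a b hab => absurd (Subsingleton.elim a b) hab)
    rw [heq] at he
    obtain ⟨e⟩ := he
    refine ⟨?_, ⟨e⟩⟩
    exact Representation.IsIrreducible.of_equiv (W := (orbitModule θ (rootElem hij α)).toSubmodule) e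
      (isIrreducible_orbitModule h2 hθ hj (rootElem_mem_rowSet hij α))
  · obtain ⟨hjj, -⟩ := rev_lt_of_mem_rightTriangle hr
    have hj : j < i.rev := (mem_rootPos.1 hij).2.resolve_right fun h => ht h.1
    have hrow := minorElem_mem_rowSet ht hr hjj α
    have hcover : ∀ B ∈ rowSet i j α, ∃ β, B ∈ orbit (minorElem ht hr α β) := fun B hB =>
      exists_mem_orbit_minorElem h2 ht hr hjj hα hB
    have hdisj : Pairwise (Function.onFun Disjoint fun β => orbit (minorElem ht hr α β)) :=
      fun β γ h => disjoint_orbit_minorElem h2 ht hr hjj hj hα h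
    refine ⟨nonempty_equiv_vergeModule h2 hθ hij hj hα hρ _
      (minorElem_mem_leftRowSet ht hr α) hcover hdisj, iSupIndep_supported hdisj, ?_,
      fun β => isIrreducible_orbitModule h2 hθ hj (hrow β),
      fun β γ h => isEmpty_equiv_orbitModule h2 hθ hj (hrow β) (hrow γ) (hdisj h)⟩
    rw [vergeModule_toSubmodule θ hij hα]
    refine (Finsupp.supported_iUnion _).symm.trans (congrArg _ (Set.Subset.antisymm ?_ ?_))
    · exact Set.iUnion_subset fun β => orbit_subset_rowSet (hrow β)
    · exact fun B hB => Set.mem_iUnion.2 (hcover B hB)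
  · rintro ⟨rfl, rfl⟩
    exact ⟨isIrreducible_long hij h2 hθ hα hρ, finrank_intertwiningMap_long hij h2 hθ hα hρ⟩
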